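/- Let $n,m\in\mathbb N$ and $T>0$, and let $A$ be the finite set of all $n$-multi-indices $\alpha$ with $|\alpha|\le 2m$. Let $R\colon[0,T]\to\mathbb R^{A}$, $R(t)=(\rho_\alpha(t))_{\alpha\in A}$, be a continuous map. For $0\le k\le 2m$, $t\in[0,T]$ and $\xi\in\mathbb R^n\setminus\{0\}$ put $$\rho_k(t,\xi):=(-1)^k\,\frac{\sum_{|\alpha|=k}\rho_\alpha(t)\,\xi^\alpha}{|\xi|^k},$$ and assume that there is $\Lambda>0$ such that, for all $t\in[0,T]$ and $\xi\in\mathbb R^n\setminus\{0\}$, $$|\rho_k(t,\xi)|\le\Lambda\quad(k=0,\dots,2m-1)\qquad\text{and}\qquad \frac1\Lambda\le\rho_{2m}(t,\xi)\le\Lambda .$$ For $\tau\in[0,1]$ let $\mu(R,\tau):=\sup\{\|R(t)-R(s)\| : t,s\in[0,T],\ |t-s|\le\tau\}$ be the modulus of continuity of $R$, and assume that it satisfies the Osgood condition $$\int_0^1\frac{ds}{\mu(R,s)}=+\infty$$ (with $1/0=+\infty$, so that constant $R$ are included). Let $u\in H^1([0,T],L^2(\mathbb R^n))\cap L^2([0,T],H^{2m}(\mathbb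 R^n))$ be complex-valued, and suppose that for some constant $\tilde C$ the backward-parabolic inequality $$\Big\|\partial_t u(t,\cdot)-\sum_{|\alpha|\le 2m} i^{|\alpha|}\rho_\alpha(t)\,\partial_x^\alpha u(t,\cdot)\Big\|_{L^2(\mathbb R^n)}\le\tilde C\,\|u(t,\cdot)\|_{H^m(\mathbb R^n)}$$ holds for almost every $t\in[0,T]$, and that $u(0,\cdot)=0$, where $u(0,\cdot)$ is the value at $t=0$ of the continuous representative $[0,T]\to L^2(\mathbb R^n)$ of $u$. Then $u=0$ in $[0,T]\times\mathbb R^n$ (almost everywhere). -/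

import Mathlib

open MeasureTheory Set
open scoped SchwartzMap LineDeriv ContDiff

noncomputable section

/-! ### Moduli of continuity -/

/-- The modulus of continuity `τ ↦ sup {‖f t - f s‖ : t, s ∈ I, |t - s| ≤ τ}` of `f` on `I`. -/
def modulusOfContinuity {B : Type*} [NormedAddCommGroup B] (I : Set ℝ) (f : ℝ → B) (τ : ℝ) : ℝ :=
  sSup {r : ℝ | ∃ t ∈ I, ∃ s ∈ I, |t - s| ≤ τ ∧ r = ‖f t - f s‖}

/-- The Osgood condition `∫₀¹ ds / μ(s) = +∞` for a nondecreasing `μ ≥ 0` on `[0, 1]`.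
The integrand takes values in `[0, ∞]`, with `1 / 0 = ∞`, so that `μ = 0` (the modulus of
continuity of a constant function) satisfies the condition. -/
def OsgoodCondition (μ : ℝ → ℝ) : Prop :=
  ∫⁻ s in Ioc (0 : ℝ) 1, (ENNReal.ofReal (μ s))⁻¹ = ⊤

/-! ### Multi-indices -/

/-- The weight `|α| = α₁ + ⋯ + αₙ` of a multi-index. -/
def weight {n : ℕ} (α : Fin n → ℕ) : ℕ := ∑ i, α i

/-- The finite set of all `n`-multi-indices of weight at most `k`. -/
def multiIndices (n k : ℕ) : Finset (Fin n → ℕ) :=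
  (Fintype.piFinset fun _ : Fin n => Finset.range (k + 1)).filter fun α => weight α ≤ k

theorem mem_multiIndices {n k : ℕ} {α : Fin n → ℕ} : α ∈ multiIndices n k ↔ weight α ≤ k := by
  simp only [multiIndices, Finset.mem_filter, Fintype.mem_piFinset, Finset.mem_range,
    and_iff_right_iff_imp]
  intro h i
  have : α i ≤ weight α := Finset.single_le_sum (f := α) (fun _ _ => Nat.zero_le _) (by simp)
  omega

/-! ### Weak derivatives and Sobolev spaces in the space variable -/

/-- The complex Hilbert space `L²(ℝⁿ)`. -/
abbrev L2 (n : ℕ) : Type := Lp ℂ 2 (volume : Measure (EuclideanSpace ℝ (Fin n)))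

/-- The distributional derivative `∂ₓ^α = ∂₁^{α₁} ⋯ ∂ₙ^{αₙ}` of a tempered distribution. -/
def multiDeriv {n : ℕ} (α : Fin n → ℕ) (f : 𝓢'(EuclideanSpace ℝ (Fin n), ℂ)) :
    𝓢'(EuclideanSpace ℝ (Fin n), ℂ) :=
  (List.finRange n).foldr
    (fun i g => (fun h : 𝓢'(EuclideanSpace ℝ (Fin n), ℂ) =>
      ∂_{(EuclideanSpace.single i (1 : ℝ))} h)^[α i] g) f

/-- `g ∈ L²(ℝⁿ)` is the weak derivative `∂ₓ^α f` of `f ∈ L²(ℝⁿ)`. -/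
def IsWeakDeriv {n : ℕ} (α : Fin n → ℕ) (f g : L2 n) : Prop :=
  multiDeriv α (f : 𝓢'(EuclideanSpace ℝ (Fin n), ℂ)) = (g : 𝓢'(EuclideanSpace ℝ (Fin n), ℂ))

/-- The Sobolev space `H^k(ℝⁿ)`: all weak derivatives of order at most `k` lie in `L²(ℝⁿ)`. -/
def MemH {n : ℕ} (k : ℕ) (f : L2 n) : Prop :=
  ∀ α ∈ multiIndices n k, ∃ g : L2 n, IsWeakDeriv α f g

open Classical in
/-- The weak derivative `∂ₓ^α f` as an element of `L²(ℝⁿ)` (it is unique), and `0` if `f` has no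
such derivative in `L²(ℝⁿ)`. -/
def weakDeriv {n : ℕ} (α : Fin n → ℕ) (f : L2 n) : L2 n :=
  if h : ∃ g : L2 n, IsWeakDeriv α f g then h.choose else 0

/-- The norm of `H^k(ℝⁿ)`. -/
def normH {n : ℕ} (k : ℕ) (f : L2 n) : ℝ :=
  Real.sqrt (∑ α ∈ multiIndices n k, ‖weakDeriv α f‖ ^ 2)

/-! ### Function spaces on `[0, T] × ℝⁿ`

A function `u` on `[0, T] × ℝⁿ` is viewed as the `L²(ℝⁿ)`-valued map `t ↦ u(t, ·)`. -/

/-- `v` is the weak time derivative of `u` on `(0, T)`. -/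
def IsWeakTimeDeriv {n : ℕ} (T : ℝ) (u v : ℝ → L2 n) : Prop :=
  ∀ φ : ℝ → ℝ, ContDiff ℝ ∞ φ → HasCompactSupport φ → tsupport φ ⊆ Ioo 0 T →
    ∫ t in Icc 0 T, deriv φ t • u t = -∫ t in Icc 0 T, φ t • v t

/-- `u ∈ H¹([0, T], L²(ℝⁿ))`, with weak time derivative `u'`. -/
def MemTimeH1 {n : ℕ} (T : ℝ) (u u' : ℝ → L2 n) : Prop :=
  MemLp u 2 (volume.restrict (Icc 0 T)) ∧ MemLp u' 2 (volume.restrict (Icc 0 T)) ∧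
    IsWeakTimeDeriv T u u'

/-- `u ∈ L²([0, T], H^k(ℝⁿ))`. Since `f ↦ (∂ₓ^α f)_{|α| ≤ k}` is an isometric embedding of
`H^k(ℝⁿ)` into a finite product of copies of `L²(ℝⁿ)`, measurability and square integrability
are expressed for each derivative. -/
def MemTimeL2H {n : ℕ} (T : ℝ) (k : ℕ) (u : ℝ → L2 n) : Prop :=
  (∀ᵐ t ∂(volume.restrict (Icc 0 T)), MemH k (u t)) ∧
    ∀ α ∈ multiIndices n k,
      MemLp (fun t => weakDeriv α (u t)) 2 (volume.restrict (Icc 0 T))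

/-- `u(0, ·) = 0`: the continuous representative `[0, T] → L²(ℝⁿ)` of `u` vanishes at `t = 0`. -/
def VanishesAtZero {n : ℕ} (T : ℝ) (u : ℝ → L2 n) : Prop :=
  ∃ w : ℝ → L2 n, ContinuousOn w (Icc 0 T) ∧
    (∀ᵐ t ∂(volume.restrict (Icc 0 T)), u t = w t) ∧ w 0 = 0

/-! ### The operator -/

/-- `ρ_k(t, ξ) = (-1)^k (∑_{|α| = k} ρ_α(t) ξ^α) / |ξ|^k`, for the coefficient vector
`r = (ρ_α(t))_{|α| ≤ N}`. -/
def homogeneousSymbol {n N : ℕ} (r : EuclideanSpace ℝ (multiIndices n N)) (k : ℕ)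
    (ξ : EuclideanSpace ℝ (Fin n)) : ℝ :=
  (-1) ^ k * (∑ α : multiIndices n N with weight α.1 = k, r α * ∏ i, ξ i ^ α.1 i) / ‖ξ‖ ^ k

/-- Boundedness of the lower order symbols, and ellipticity and boundedness of the principal
symbol, with constant `Λ`, uniformly on `[0, T] × (ℝⁿ ∖ {0})`. -/
def EllipticBounded {n m : ℕ} (T Λ : ℝ) (R : ℝ → EuclideanSpace ℝ (multiIndices n (2 * m))) :
    Prop :=
  ∀ t ∈ Icc 0 T, ∀ ξ : EuclideanSpace ℝ (Fin n), ξ ≠ 0 →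
    (∀ k < 2 * m, |homogeneousSymbol (R t) k ξ| ≤ Λ) ∧
      1 / Λ ≤ homogeneousSymbol (R t) (2 * m) ξ ∧ homogeneousSymbol (R t) (2 * m) ξ ≤ Λ

/-- The spatial operator `f ↦ ∑_{|α| ≤ N} i^{|α|} ρ_α ∂ₓ^α f` for the coefficient vector `r`. -/
def spatialOp {n N : ℕ} (r : EuclideanSpace ℝ (multiIndices n N)) (f : L2 n) : L2 n :=
  ∑ α : multiIndices n N, (Complex.I ^ weight α.1 * (r α : ℂ)) • weakDeriv α.1 f

end

/-! After the Fourier transform in space, `w = 𝓕 u` satisfies `w' = p w + g` and `w 0 = 0`. Here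
`p(t, ξ)` is real and lies between `a X - b` and `b X`, where `X = 1 + |2πξ|^{2m}`, and `‖g‖² ≤ C₂ ∫
X |w|²`. The proof is a Carleman estimate carried out frequency by frequency.

Take a decreasing weight `φ ≥ N` on `[0, τ]`, put `E = exp (2 ∫_t^τ φ)`, choose a time-independent
level `c ξ`, and differentiate `E ⟨(c - φ) w, w⟩`. With `s = c - φ`, the density of the derivative
is `E (-φ' + 2 s (p - φ)) |w|²`, up to the contribution of `g`. Except at very high frequencies, `c
ξ` is the value of `φ` at the first time `t₀` at which `p(·, ξ)` reaches `φ`. Then `s ≤ 0` before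
`t₀` and `s ≥ 0` after it, and `p - φ` follows the sign of `s` up to the oscillation of `p`. For
constant coefficients this gives `s (p - φ) ≥ s²`. In general the loss is `|s| L X σ(|t - t₀|)`,
which a weight with `-φ' = M φ² σ(1/φ)` absorbs where `φ` is of size at least `X`
(`multiplier_near`, `multiplier_pointwise`).

The Osgood condition makes such weights available: `h = 1/φ` solves `h' = M σ(h)`, and divergence of
`∫ ds/σ` at `0` means that a solution equal to `1/N` at time `τ` stays positive back to time `0`,
however large `τ` is (`OsgoodModulus.exists_solution`).

The energy vanishes at `0`, and at `τ` it is at most `b ∫ X |w(τ)|²`, which does not involve `N`. On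
`[0, τ']` with `τ' < τ` the factor `E` is at least `exp (2N(τ - τ'))` (`carleman_estimate`), so
letting `N → ∞` forces `w = 0` there. -/

open scoped FourierTransform

/-! ### Osgood moduli -/

/-- A nondecreasing subadditive function `σ ≥ id`, continuous on `(0, ∞)`, with
`∫₀¹ ds / σ(s) = ∞`. -/
structure OsgoodModulus (σ : ℝ → ℝ) : Prop where
  mono : ∀ ⦃s t : ℝ⦄, 0 ≤ s → s ≤ t → σ s ≤ σ t
  subadd : ∀ ⦃s t : ℝ⦄, 0 ≤ s → 0 ≤ t → σ (s + t) ≤ σ s + σ t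
  le : ∀ ⦃s : ℝ⦄, 0 ≤ s → s ≤ σ s
  cont : ContinuousOn σ (Ioi 0)
  unbounded : ∀ K : ℝ, ∃ x ∈ Ioc (0 : ℝ) 1, K ≤ ∫ s in x..1, (σ s)⁻¹

namespace OsgoodModulus

theorem pos {σ : ℝ → ℝ} (h : OsgoodModulus σ) {s : ℝ} (hs : 0 < s) : 0 < σ s :=
  hs.trans_le (h.le hs.le)

end OsgoodModulus

theorem subadditive_natMul_le {σ : ℝ → ℝ}
    (subadd : ∀ ⦃s t : ℝ⦄, 0 ≤ s → 0 ≤ t → σ (s + t) ≤ σ s + σ t) {s : ℝ} (hs : 0 ≤ s) (k : ℕ) :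
    σ ((k + 1 : ℕ) * s) ≤ (k + 1 : ℕ) * σ s := by
  induction k with
  | zero => simp
  | succ k ih =>
    have := subadd (s := (k + 1 : ℕ) * s) (t := s) (by positivity) hs
    push_cast at *
    rw [show ((k : ℝ) + 1 + 1) * s = (k + 1) * s + s by ring]
    linarith

/-- Cover `[0, y]` by `⌊y / s⌋ + 1` steps of length `s`. This comparison of scales replaces
concavity of `σ` throughout. -/
theorem subadditive_le_one_add_div_mul {σ : ℝ → ℝ}
    (mono : ∀ ⦃s t : ℝ⦄, 0 ≤ s → s ≤ t → σ s ≤ σ t)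
    (subadd : ∀ ⦃s t : ℝ⦄, 0 ≤ s → 0 ≤ t → σ (s + t) ≤ σ s + σ t) {s y : ℝ} (hs : 0 < s)
    (hy : 0 ≤ y) (h0 : 0 ≤ σ s) : σ y ≤ (1 + y / s) * σ s := by
  have h1 : y ≤ (⌊y / s⌋₊ + 1 : ℕ) * s := by
    have := (Nat.lt_floor_add_one (y / s)).le
    rw [div_le_iff₀ hs] at this
    push_cast
    exact this
  refine (mono hy h1).trans ((subadditive_natMul_le subadd hs.le _).trans ?_)
  gcongr
  push_cast
  linarith [Nat.floor_le (div_nonneg hy hs.le)]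

/-! ### The modulus of continuity of a map on a compact interval. -/

section Modulus

variable {B : Type*} [NormedAddCommGroup B] {T : ℝ} {f : ℝ → B}

theorem modulusOfContinuity_bddAbove (hf : ContinuousOn f (Icc 0 T)) (τ : ℝ) :
    BddAbove {r : ℝ | ∃ t ∈ Icc 0 T, ∃ s ∈ Icc 0 T, |t - s| ≤ τ ∧ r = ‖f t - f s‖} := by
  obtain ⟨K, hK⟩ := isCompact_Icc.exists_bound_of_continuousOn hf
  refine ⟨K + K, ?_⟩
  rintro _ ⟨t, ht, s, hs, -, rfl⟩
  exact (norm_sub_le _ _).trans (add_le_add (hK t ht) (hK s hs))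

theorem norm_sub_le_modulusOfContinuity (hf : ContinuousOn f (Icc 0 T)) {t s τ : ℝ}
    (ht : t ∈ Icc 0 T) (hs : s ∈ Icc 0 T) (h : |t - s| ≤ τ) :
    ‖f t - f s‖ ≤ modulusOfContinuity (Icc 0 T) f τ :=
  le_csSup (modulusOfContinuity_bddAbove hf τ) ⟨t, ht, s, hs, h, rfl⟩

theorem modulusOfContinuity_le (hT : 0 ≤ T) {τ K : ℝ} (hτ : 0 ≤ τ)
    (h : ∀ t ∈ Icc 0 T, ∀ s ∈ Icc 0 T, |t - s| ≤ τ → ‖f t - f s‖ ≤ K) :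
    modulusOfContinuity (Icc 0 T) f τ ≤ K := by
  refine csSup_le ⟨_, 0, ⟨le_rfl, hT⟩, 0, ⟨le_rfl, hT⟩, by simpa using hτ, rfl⟩ ?_
  rintro _ ⟨t, ht, s, hs, hts, rfl⟩
  exact h t ht s hs hts

theorem modulusOfContinuity_nonneg (τ : ℝ) : 0 ≤ modulusOfContinuity (Icc 0 T) f τ :=
  Real.sSup_nonneg (by rintro _ ⟨t, -, s, -, -, rfl⟩; positivity)

theorem modulusOfContinuity_mono (hT : 0 ≤ T) (hf : ContinuousOn f (Icc 0 T)) {s t : ℝ}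
    (hs : 0 ≤ s) (hst : s ≤ t) :
    modulusOfContinuity (Icc 0 T) f s ≤ modulusOfContinuity (Icc 0 T) f t :=
  modulusOfContinuity_le hT hs fun _ ha _ hb h =>
    norm_sub_le_modulusOfContinuity hf ha hb (h.trans hst)

/-- Convexity of the interval supplies an intermediate point, `min (a + s) b`, within `s` of one end
and `t` of the other. -/
theorem modulusOfContinuity_add_le (hT : 0 ≤ T) (hf : ContinuousOn f (Icc 0 T)) {s t : ℝ}
    (hs : 0 ≤ s) (ht : 0 ≤ t) :
    modulusOfContinuity (Icc 0 T) f (s + t) ≤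
      modulusOfContinuity (Icc 0 T) f s + modulusOfContinuity (Icc 0 T) f t := by
  have key : ∀ a ∈ Icc 0 T, ∀ b ∈ Icc 0 T, a ≤ b → b - a ≤ s + t → ‖f a - f b‖ ≤
      modulusOfContinuity (Icc 0 T) f s + modulusOfContinuity (Icc 0 T) f t := by
    intro a ha b hb hab h
    have hc : min (a + s) b ∈ Icc 0 T :=
      ⟨le_min (by linarith [ha.1]) hb.1, (min_le_right _ _).trans hb.2⟩
    have h1 : |a - min (a + s) b| ≤ s := by
      rw [abs_sub_comm, abs_of_nonneg (by simp [hs, hab])]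
      linarith [min_le_left (a + s) b]
    have h2 : |min (a + s) b - b| ≤ t := by
      rw [abs_sub_comm, abs_of_nonneg (by simp)]
      rcases min_cases (a + s) b with h | h <;> rw [h.1] <;> linarith
    calc ‖f a - f b‖ = ‖(f a - f (min (a + s) b)) + (f (min (a + s) b) - f b)‖ := by
          congr 1; abel
      _ ≤ _ := (norm_add_le _ _).trans (add_le_add
          (norm_sub_le_modulusOfContinuity hf ha hc h1)
          (norm_sub_le_modulusOfContinuity hf hc hb h2))
  refine modulusOfContinuity_le hT (add_nonneg hs ht) fun a ha b hb h => ?_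
  rcases le_total a b with hab | hab
  · exact key a ha b hb hab (by rw [abs_sub_comm] at h; exact (le_abs_self _).trans h)
  · rw [norm_sub_rev]
    exact key b hb a ha hab ((le_abs_self _).trans h)

/-- By subadditivity an increment of the modulus is at most the modulus of the increment, which is
small by uniform continuity of `f`. -/
theorem modulusOfContinuity_continuousOn (hT : 0 ≤ T) (hf : ContinuousOn f (Icc 0 T)) :
    ContinuousOn (modulusOfContinuity (Icc 0 T) f) (Ioi 0) := by
  set μ := modulusOfContinuity (Icc 0 T) f with hμ
  have huc := isCompact_Icc.uniformContinuousOn_of_continuous hf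
  rw [Metric.uniformContinuousOn_iff_le] at huc
  rw [Metric.continuousOn_iff]
  intro x hx ε hε
  obtain ⟨δ, hδ, h⟩ := huc (ε / 2) (by positivity)
  have hsmall : ∀ r, 0 ≤ r → r ≤ δ → μ r ≤ ε / 2 := fun r hr hrδ =>
    modulusOfContinuity_le hT hr fun t ht s hs hts => by
      rw [← dist_eq_norm]
      exact h t ht s hs (by rw [Real.dist_eq]; exact hts.trans hrδ)
  have key : ∀ a b : ℝ, 0 < a → a ≤ b → b - a ≤ δ → |μ b - μ a| ≤ ε / 2 := by
    intro a b ha hab hδ'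
    have h1 := modulusOfContinuity_mono hT hf ha.le hab
    have h2 := modulusOfContinuity_add_le hT hf ha.le (sub_nonneg.2 hab)
    rw [add_sub_cancel] at h2
    rw [abs_of_nonneg (sub_nonneg.2 h1)]
    linarith [hsmall (b - a) (sub_nonneg.2 hab) hδ']
  refine ⟨δ, hδ, fun y hy hyx => ?_⟩
  rw [Real.dist_eq] at hyx ⊢
  rcases le_total x y with hxy | hxy
  · exact (key x y hx hxy (by linarith [le_abs_self (y - x)])).trans_lt (by linarith)
  · rw [abs_sub_comm]
    exact (key y x hy hxy (by linarith [neg_abs_le (y - x)])).trans_lt (by linarith)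

/-- Adding `s` makes the modulus positive even for constant `f`. Divergence survives: if `μ 1 = 0`
the integrand becomes `1 / s`; otherwise subadditivity gives `s ≤ (2 / μ 1) μ s`, so the sum is
comparable to `μ`. -/
theorem OsgoodCondition.add_id (hT : 0 ≤ T) (hf : ContinuousOn f (Icc 0 T))
    (h : OsgoodCondition (modulusOfContinuity (Icc 0 T) f)) :
    OsgoodCondition fun s => modulusOfContinuity (Icc 0 T) f s + s := by
  set μ := modulusOfContinuity (Icc 0 T) f with hμ
  unfold OsgoodCondition at *
  have hlog : ∫⁻ s in Ioc (0 : ℝ) 1, (ENNReal.ofReal s)⁻¹ = ⊤ := by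
    by_contra hne
    have hint : IntegrableOn (fun s : ℝ => s⁻¹) (Ioc 0 1) := by
      refine ⟨by fun_prop, ?_⟩
      rw [hasFiniteIntegral_iff_ofReal
        ((ae_restrict_iff' measurableSet_Ioc).2 (.of_forall fun s hs => by
          have := hs.1; simp only [Pi.zero_apply]; positivity))]
      refine lt_of_le_of_lt (le_of_eq ?_) (lt_top_iff_ne_top.2 hne)
      refine setLIntegral_congr_fun measurableSet_Ioc fun s hs => ?_
      exact ENNReal.ofReal_inv_of_pos hs.1
    rw [← intervalIntegrable_iff_integrableOn_Ioc_of_le zero_le_one] at hint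
    simp at hint
  rcases (modulusOfContinuity_nonneg (T := T) (f := f) 1).eq_or_lt with h1 | h1
  · refine hlog ▸ setLIntegral_congr_fun measurableSet_Ioc fun s hs => ?_
    have : μ s = 0 := le_antisymm
      ((modulusOfContinuity_mono hT hf hs.1.le hs.2).trans h1.ge) (modulusOfContinuity_nonneg s)
    simp [this]
  · set K : ℝ := 1 + 2 / μ 1 with hK
    have hK0 : 0 < K := by positivity
    have hle : ∀ s ∈ Ioc (0 : ℝ) 1, μ s + s ≤ K * μ s := by
      intro s hs
      have h2 : μ 1 ≤ (1 + 1 / s) * μ s :=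
        subadditive_le_one_add_div_mul (fun s t hs hst => modulusOfContinuity_mono hT hf hs hst)
          (fun s t hs ht => modulusOfContinuity_add_le hT hf hs ht) hs.1 zero_le_one
          (modulusOfContinuity_nonneg s)
      have h3 : s * μ 1 ≤ 2 * μ s := by
        have h4 := mul_le_mul_of_nonneg_left h2 hs.1.le
        have h5 : s * ((1 + 1 / s) * μ s) = (s + 1) * μ s := by field_simp [hs.1.ne']
        rw [h5] at h4
        exact h4.trans (mul_le_mul_of_nonneg_right (by linarith [hs.2])
          (modulusOfContinuity_nonneg s))
      have : s ≤ 2 / μ 1 * μ s := by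
        rw [div_mul_eq_mul_div, le_div_iff₀ h1]; exact h3
      rw [hK]; linarith
    have hmul : ∫⁻ s in Ioc (0 : ℝ) 1, (ENNReal.ofReal (μ s))⁻¹ ≤
        ENNReal.ofReal K * ∫⁻ s in Ioc (0 : ℝ) 1, (ENNReal.ofReal (μ s + s))⁻¹ := by
      rw [← lintegral_const_mul' _ _ ENNReal.ofReal_ne_top]
      refine setLIntegral_mono' measurableSet_Ioc fun s hs => ?_
      have h5 : ENNReal.ofReal (μ s + s) ≤ ENNReal.ofReal K * ENNReal.ofReal (μ s) := by
        rw [← ENNReal.ofReal_mul hK0.le]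
        exact ENNReal.ofReal_le_ofReal (hle s hs)
      have h6 := ENNReal.inv_le_inv.2 h5
      rw [ENNReal.mul_inv (Or.inl (by simpa using hK0)) (Or.inl ENNReal.ofReal_ne_top)] at h6
      calc (ENNReal.ofReal (μ s))⁻¹
          = ENNReal.ofReal K * ((ENNReal.ofReal K)⁻¹ * (ENNReal.ofReal (μ s))⁻¹) := by
            rw [← mul_assoc, ENNReal.mul_inv_cancel (by simpa using hK0) ENNReal.ofReal_ne_top,
              one_mul]
        _ ≤ _ := by gcongr
    rw [h, top_le_iff, ENNReal.mul_eq_top] at hmul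
    rcases hmul with hm | hm
    · exact hm.2
    · exact absurd hm.1 ENNReal.ofReal_ne_top

theorem osgoodModulus_of_osgoodCondition (hT : 0 ≤ T) (hf : ContinuousOn f (Icc 0 T))
    (h : OsgoodCondition (modulusOfContinuity (Icc 0 T) f)) :
    OsgoodModulus fun s => modulusOfContinuity (Icc 0 T) f s + s := by
  have hcont : ContinuousOn (fun s => modulusOfContinuity (Icc 0 T) f s + s) (Ioi 0) :=
    (modulusOfContinuity_continuousOn hT hf).add continuousOn_id
  have hpos : ∀ s : ℝ, 0 < s → 0 < modulusOfContinuity (Icc 0 T) f s + s := fun s hs =>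
    add_pos_of_nonneg_of_pos (modulusOfContinuity_nonneg s) hs
  refine ⟨fun s t hs hst => add_le_add (modulusOfContinuity_mono hT hf hs hst) hst,
    fun s t hs ht => by linarith [modulusOfContinuity_add_le hT hf hs ht],
    fun s _ => le_add_of_nonneg_left (modulusOfContinuity_nonneg s), hcont, fun K => ?_⟩
  by_contra! hK
  have hint : ∀ i : ℕ, IntegrableOn (fun s => (modulusOfContinuity (Icc 0 T) f s + s)⁻¹)
      (Ioc ((i : ℝ) + 1)⁻¹ 1) := fun i => by
    refine (ContinuousOn.integrableOn_Icc ?_).mono_set Ioc_subset_Icc_self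
    have hsub : Icc ((i : ℝ) + 1)⁻¹ 1 ⊆ Ioi (0 : ℝ) := fun s hs =>
      lt_of_lt_of_le (by positivity) hs.1
    exact (hcont.mono hsub).inv₀ fun s hs => (hpos s (hsub hs)).ne'
  have hlim : Filter.Tendsto (fun i : ℕ => ((i : ℝ) + 1)⁻¹) Filter.atTop (nhds 0) := by
    simpa using tendsto_one_div_add_atTop_nhds_zero_nat (𝕜 := ℝ)
  have := integrableOn_Ioc_of_intervalIntegral_norm_bounded_left (I := K) hint hlim
    (.of_forall fun i => by
      have hi : ((i : ℝ) + 1)⁻¹ ≤ 1 := inv_le_one_of_one_le₀ (by simp)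
      have := (hK ((i : ℝ) + 1)⁻¹ ⟨by positivity, hi⟩).le
      rw [intervalIntegral.integral_of_le hi] at this
      refine le_trans (le_of_eq (setIntegral_congr_fun measurableSet_Ioc fun s hs => ?_)) this
      exact Real.norm_of_nonneg (inv_nonneg.2 (hpos s (lt_trans (by positivity) hs.1)).le))
  have hfin := this.2
  rw [hasFiniteIntegral_iff_ofReal ((ae_restrict_iff' measurableSet_Ioc).2
    (.of_forall fun s hs => (inv_nonneg.2 (hpos s hs.1).le)))] at hfin
  refine hfin.ne ((OsgoodCondition.add_id hT hf h) ▸ ?_)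
  refine setLIntegral_congr_fun measurableSet_Ioc fun s hs => ?_
  exact ENNReal.ofReal_inv_of_pos (hpos s hs.1)

end Modulus

/-! ### The Osgood equation and the Carleman weights it produces. -/

/-- Solutions of the Osgood equation `h' = M σ(h)` stay arbitrarily small on a given interval. -/
theorem OsgoodModulus.exists_solution {σ : ℝ → ℝ} (hσ : OsgoodModulus σ) {M η τ : ℝ} (hM : 0 < M)
    (hη : 0 < η) :
    ∃ h : ℝ → ℝ, ∀ t ∈ Icc 0 τ, 0 < h t ∧ h t ≤ η ∧ HasDerivAt h (M * σ (h t)) t := by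
  -- `G x` is the signed time the flow of `h' = M σ(h)` takes from `1` to `x`, so solutions are
  -- translates of its inverse. The Osgood condition makes `G` unbounded below near `0`.
  set G : ℝ → ℝ := fun x => ∫ s in (1 : ℝ)..x, (M * σ s)⁻¹ with hG
  have hcont : ContinuousOn (fun s => (M * σ s)⁻¹) (Ioi 0) :=
    (continuousOn_const.mul hσ.cont).inv₀ fun s hs => (mul_pos hM (hσ.pos hs)).ne'
  have hGd : ∀ x, 0 < x → HasDerivAt G (M * σ x)⁻¹ x := fun x hx => by
    refine intervalIntegral.integral_hasDerivAt_right ?_ ?_ ?_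
    · refine (hcont.mono fun s hs => ?_).intervalIntegrable
      exact lt_of_lt_of_le (lt_min one_pos hx) hs.1
    · exact hcont.stronglyMeasurableAtFilter isOpen_Ioi x hx
    · exact hcont.continuousAt (Ioi_mem_nhds hx)
  have hGc : ContinuousOn G (Ioi 0) := fun x hx => (hGd x hx).continuousAt.continuousWithinAt
  have hGm : StrictMonoOn G (Ioi 0) := by
    refine strictMonoOn_of_deriv_pos (convex_Ioi 0) hGc fun x hx => ?_
    rw [interior_Ioi] at hx
    rw [(hGd x hx).deriv]
    exact inv_pos.2 (mul_pos hM (hσ.pos hx))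
  have hGunb : ∀ y, ∃ x ∈ Ioi (0 : ℝ), G x ≤ y := fun y => by
    obtain ⟨x, hx, hxK⟩ := hσ.unbounded (-(M * y))
    refine ⟨x, hx.1, ?_⟩
    have : G x = -(M⁻¹ * ∫ s in x..1, (σ s)⁻¹) := by
      simp only [hG, mul_inv]
      rw [intervalIntegral.integral_const_mul, intervalIntegral.integral_symm x 1]
      ring
    rw [this]
    have h2 := mul_le_mul_of_nonneg_left hxK (inv_nonneg.2 hM.le)
    have h3 : M⁻¹ * -(M * y) = -y := by field_simp
    linarith
  -- Inverting up to `2 * η` leaves an open neighbourhood of `η`, so that the inverse is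
  -- differentiable at the final time too.
  have hsurj : ∀ y, y < G (2 * η) → ∃ x ∈ Ioi (0 : ℝ), G x = y := fun y hy => by
    obtain ⟨x, hx, hxy⟩ := hGunb y
    have hx2 : x ≤ 2 * η := by
      by_contra! hlt
      exact absurd (hGm (show (0 : ℝ) < 2 * η by positivity) hx hlt) (by linarith)
    obtain ⟨z, hz, hzy⟩ := intermediate_value_Icc hx2
      (hGc.mono fun s hs => lt_of_lt_of_le hx hs.1) ⟨hxy, hy.le⟩
    exact ⟨z, lt_of_lt_of_le hx hz.1, hzy⟩
  choose! k hk0 hk using hsurj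
  have hGη : G η < G (2 * η) := hGm hη (show (0 : ℝ) < 2 * η by positivity) (by linarith)
  have hkm : StrictMonoOn k (Iio (G (2 * η))) := fun y hy z hz hyz => by
    by_contra! hle
    have := hGm.monotoneOn (hk0 z hz) (hk0 y hy) hle
    rw [hk z hz, hk y hy] at this
    linarith
  have hkG : ∀ x ∈ Ioo 0 (2 * η), k (G x) = x := fun x hx => by
    have hlt : G x < G (2 * η) := hGm hx.1 (hx.1.trans hx.2) hx.2
    exact hGm.injOn (hk0 _ hlt) hx.1 (hk _ hlt)
  have hkd : ∀ y < G (2 * η), HasDerivAt k (M * σ (k y)) y := fun y hy => by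
    have hpos := hk0 y hy
    have hlt : k y < 2 * η := by
      by_contra! hle
      have := hGm.monotoneOn (show (0 : ℝ) < 2 * η by positivity) hpos hle
      rw [hk y hy] at this
      linarith
    have hc : ContinuousAt k y := by
      refine hkm.continuousAt_of_image_mem_nhds (Iio_mem_nhds hy) ?_
      refine Filter.mem_of_superset (Ioo_mem_nhds hpos hlt) fun x hx => ⟨G x, ?_, hkG x hx⟩
      exact hGm hx.1 (hx.1.trans hx.2) hx.2
    have := HasDerivAt.of_local_left_inverse hc (hGd _ hpos)
      (inv_ne_zero (mul_pos hM (hσ.pos hpos)).ne')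
      (Filter.mem_of_superset (Iio_mem_nhds hy) fun z hz => hk z hz)
    rwa [inv_inv] at this
  -- The time shift puts the value `η` at `t = τ`; monotonicity gives `h ≤ η` earlier.
  refine ⟨fun t => k (G η - τ + t), fun t ht => ?_⟩
  have hlt : G η - τ + t < G (2 * η) := by linarith [ht.2]
  refine ⟨hk0 _ hlt, ?_, ?_⟩
  · exact (hkm.monotoneOn hlt hGη (by linarith [ht.2])).trans_eq (hkG η ⟨hη, by linarith⟩)
  · exact (hkd _ hlt).comp_const_add (G η - τ) t

/-- `φ` is a decreasing Carleman weight on `[0, τ]`, bounded below by `N`, for the modulus `σ`: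
`-φ' = M φ² σ(1/φ)`. -/
structure IsOsgoodWeight (σ : ℝ → ℝ) (M N τ : ℝ) (φ : ℝ → ℝ) : Prop where
  le : ∀ ⦃t⦄, t ∈ Icc 0 τ → N ≤ φ t
  hasDerivAt : ∀ ⦃t⦄, t ∈ Icc 0 τ → HasDerivAt φ (-(M * φ t ^ 2 * σ (φ t)⁻¹)) t

theorem OsgoodModulus.exists_weight {σ : ℝ → ℝ} (hσ : OsgoodModulus σ) {M N τ : ℝ} (hM : 0 < M)
    (hN : 0 < N) : ∃ φ, IsOsgoodWeight σ M N τ φ := by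
  obtain ⟨h, hh⟩ := hσ.exists_solution (τ := τ) hM (inv_pos.2 hN)
  refine ⟨fun t => (h t)⁻¹, fun t ht => ?_, fun t ht => ?_⟩
  · obtain ⟨h0, h1, -⟩ := hh t ht
    rw [le_inv_comm₀ hN h0]; exact h1
  · obtain ⟨h0, -, h2⟩ := hh t ht
    refine (h2.inv h0.ne').congr_deriv ?_
    rw [inv_inv]; field_simp

namespace IsOsgoodWeight

variable {σ : ℝ → ℝ} {M N τ : ℝ} {φ : ℝ → ℝ}

theorem continuousOn (h : IsOsgoodWeight σ M N τ φ) : ContinuousOn φ (Icc 0 τ) :=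
  fun _ ht => (h.hasDerivAt ht).continuousAt.continuousWithinAt

theorem antitoneOn (h : IsOsgoodWeight σ M N τ φ) (hσ : OsgoodModulus σ) (hM : 0 < M) (hN : 0 < N) :
    AntitoneOn φ (Icc 0 τ) := by
  refine antitoneOn_of_deriv_nonpos (convex_Icc 0 τ) h.continuousOn
    (fun t ht => (h.hasDerivAt (interior_subset ht)).differentiableAt.differentiableWithinAt)
    fun t ht => ?_
  have ht := interior_subset ht
  rw [(h.hasDerivAt ht).deriv]
  have := hσ.pos (inv_pos.2 (hN.trans_le (h.le ht)))
  simp only [Left.neg_nonpos_iff]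
  positivity

end IsOsgoodWeight

/-- A quantitative form of the growth of `y² σ(1/y)`, bounding `-φ'` below where `φ ≥ a X`. The
factor `1/2` is the price of subadditivity: `σ(1/(aX)) ≤ (1 + y/(aX)) σ(1/y) ≤ (2y/(aX)) σ(1/y)`. -/
theorem OsgoodModulus.sq_mul_le {σ : ℝ → ℝ} (hσ : OsgoodModulus σ) {a X y : ℝ} (ha : 0 < a)
    (ha1 : a ≤ 1) (hX : 0 < X) (hy : a * X ≤ y) :
    a ^ 2 / 2 * (X ^ 2 * σ X⁻¹) ≤ y ^ 2 * σ y⁻¹ := by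
  have haX : 0 < a * X := by positivity
  have hy0 : 0 < y := haX.trans_le hy
  have h1 : σ X⁻¹ ≤ σ (a * X)⁻¹ := hσ.mono (by positivity) (by
    gcongr; exact mul_le_of_le_one_left hX.le ha1)
  have h2 : σ (a * X)⁻¹ ≤ (1 + (a * X)⁻¹ / y⁻¹) * σ y⁻¹ :=
    subadditive_le_one_add_div_mul hσ.mono hσ.subadd (by positivity) (by positivity)
      (hσ.pos (by positivity)).le
  have h3 : (1 + (a * X)⁻¹ / y⁻¹) ≤ 2 * y / (a * X) := by
    rw [div_inv_eq_mul, inv_mul_eq_div, le_div_iff₀ haX, add_mul, div_mul_cancel₀ _ haX.ne']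
    linarith
  have h4 := h1.trans (h2.trans (mul_le_mul_of_nonneg_right h3 (hσ.pos (inv_pos.2 hy0)).le))
  calc a ^ 2 / 2 * (X ^ 2 * σ X⁻¹) = (a * X) ^ 2 / 2 * σ X⁻¹ := by ring
    _ ≤ (a * X) ^ 2 / 2 * (2 * y / (a * X) * σ y⁻¹) := by gcongr
    _ = (a * X) * y * σ y⁻¹ := by field_simp
    _ ≤ y * y * σ y⁻¹ := by
        have := (hσ.pos (inv_pos.2 hy0)).le
        gcongr
    _ = _ := by ring

/-! ### The multiplier -/

/-- The first time at which `p ≥ φ`, or `τ` if there is none. -/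
noncomputable def crossingTime (φ : ℝ → ℝ) (τ : ℝ) (p : ℝ → ℝ) : ℝ :=
  sInf {t | t ∈ Icc 0 τ ∧ (φ t ≤ p t ∨ t = τ)}

/-- The multiplier at a frequency of size `X` with symbol `p`. -/
noncomputable def crossingLevel (φ : ℝ → ℝ) (τ a X : ℝ) (p : ℝ → ℝ) : ℝ :=
  if 6 * φ 0 ≤ a * X then 2 * φ 0 else φ (crossingTime φ τ p)

/-! ### Crossing times: attainment and measurability. -/

section Crossing

variable {φ p : ℝ → ℝ} {τ : ℝ}

theorem crossingTime_mem_set (hτ : 0 ≤ τ) (hφ : ContinuousOn φ (Icc 0 τ))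
    (hp : ContinuousOn p (Icc 0 τ)) :
    crossingTime φ τ p ∈ {t | t ∈ Icc 0 τ ∧ (φ t ≤ p t ∨ t = τ)} := by
  refine IsClosed.csInf_mem ?_ ⟨τ, ⟨hτ, le_rfl⟩, Or.inr rfl⟩ ⟨0, fun t ht => ht.1.1⟩
  have : {t | t ∈ Icc 0 τ ∧ (φ t ≤ p t ∨ t = τ)} =
      {t | t ∈ Icc 0 τ ∧ φ t ≤ p t} ∪ (Icc 0 τ ∩ {τ}) := by
    ext t; simp only [mem_ofPred_eq, mem_union, mem_inter_iff, mem_singleton_iff]; tauto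
  rw [this]
  exact (isClosed_Icc.isClosed_le hφ hp).union (isClosed_Icc.inter isClosed_singleton)

theorem le_of_crossingTime_lt (hτ : 0 ≤ τ) (hφ : ContinuousOn φ (Icc 0 τ))
    (hp : ContinuousOn p (Icc 0 τ)) (h : crossingTime φ τ p < τ) :
    φ (crossingTime φ τ p) ≤ p (crossingTime φ τ p) :=
  (crossingTime_mem_set hτ hφ hp).2.resolve_right h.ne

/-- Strictly before the infimum `p < φ`; positivity of the crossing time provides points on its left
along which to pass to the limit. -/
theorem le_of_crossingTime_pos (hτ : 0 ≤ τ) (hφ : ContinuousOn φ (Icc 0 τ))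
    (hp : ContinuousOn p (Icc 0 τ)) (h : 0 < crossingTime φ τ p) :
    p (crossingTime φ τ p) ≤ φ (crossingTime φ τ p) := by
  have hmem := (crossingTime_mem_set hτ hφ hp).1
  have hIco : Ico 0 (crossingTime φ τ p) ⊆ Icc 0 τ := fun s hs => ⟨hs.1, hs.2.le.trans hmem.2⟩
  have hc : crossingTime φ τ p ∈ closure (Ico 0 (crossingTime φ τ p)) := by
    rw [closure_Ico h.ne]; exact ⟨hmem.1, le_rfl⟩
  have : (nhdsWithin (crossingTime φ τ p) (Ico 0 (crossingTime φ τ p))).NeBot :=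
    mem_closure_iff_nhdsWithin_neBot.1 hc
  refine le_of_tendsto_of_tendsto ((hp _ hmem).mono hIco) ((hφ _ hmem).mono hIco) ?_
  filter_upwards [self_mem_nhdsWithin] with s hs
  by_contra! hlt
  have hn : s ∉ {t | t ∈ Icc 0 τ ∧ (φ t ≤ p t ∨ t = τ)} :=
    notMem_of_lt_csInf hs.2 ⟨0, fun t ht => ht.1.1⟩
  exact hn ⟨hIco hs, Or.inl hlt.le⟩

/-- The restriction `r < τ` excludes the default value `τ`, which does not witness a crossing. -/
theorem crossingTime_le_iff (hτ : 0 ≤ τ) (hφ : ContinuousOn φ (Icc 0 τ))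
    (hp : ContinuousOn p (Icc 0 τ)) {r : ℝ} (hr : r < τ) :
    crossingTime φ τ p ≤ r ↔ ∃ t ∈ Icc 0 r, φ t ≤ p t := by
  constructor
  · intro h
    exact ⟨_, ⟨(crossingTime_mem_set hτ hφ hp).1.1, h⟩,
      le_of_crossingTime_lt hτ hφ hp (h.trans_lt hr)⟩
  · rintro ⟨t, ht, h⟩
    have hmem : t ∈ {t | t ∈ Icc 0 τ ∧ (φ t ≤ p t ∨ t = τ)} :=
      ⟨⟨ht.1, ht.2.trans hr.le⟩, Or.inl h⟩
    exact (csInf_le ⟨0, fun t ht => ht.1.1⟩ hmem).trans ht.2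

/-- Each sublevel set with `r < τ` is the projection, along the compact factor `[0, r]`, of a closed
set, hence closed. -/
theorem measurable_crossingTime {Ω : Type*} [TopologicalSpace Ω] [MeasurableSpace Ω]
    [OpensMeasurableSpace Ω] {P : ℝ → Ω → ℝ} (hτ : 0 ≤ τ) (hφ : ContinuousOn φ (Icc 0 τ))
    (hP : ContinuousOn (fun z : ℝ × Ω => P z.1 z.2) (Icc 0 τ ×ˢ univ)) :
    Measurable fun ξ => crossingTime φ τ fun t => P t ξ := by
  have hp : ∀ ξ, ContinuousOn (fun t => P t ξ) (Icc 0 τ) := fun ξ =>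
    hP.comp (by fun_prop : ContinuousOn (fun t : ℝ => (t, ξ)) (Icc 0 τ)) fun t ht => ⟨ht, trivial⟩
  refine measurable_of_Iic fun r => ?_
  rcases lt_or_ge r τ with hr | hr
  · refine IsClosed.measurableSet ?_
    have hsub : Icc 0 r ⊆ Icc 0 τ := Icc_subset_Icc_right hr.le
    have hcl : IsClosed {z : Icc 0 r × Ω | φ z.1 ≤ P z.1 z.2} := by
      refine isClosed_le ?_ ?_
      · exact (continuousOn_iff_continuous_domRestrict.1 (hφ.mono hsub)).comp continuous_fst
      · exact hP.comp_continuous (f := fun z : Icc 0 r × Ω => ((z.1 : ℝ), z.2)) (by fun_prop)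
          fun z => ⟨hsub z.1.2, trivial⟩
    convert isClosedMap_snd_of_compactSpace _ hcl
    ext ξ
    simp only [mem_preimage, mem_Iic, crossingTime_le_iff hτ hφ (hp ξ) hr, mem_image, mem_ofPred_eq,
      Prod.exists, exists_eq_right, Subtype.exists]
    exact ⟨fun ⟨t, h1, h2⟩ => ⟨t, h1, h2⟩, fun ⟨t, h1, h2⟩ => ⟨t, h1, h2⟩⟩
  · convert MeasurableSet.univ
    ext ξ
    simp only [mem_preimage, mem_Iic, mem_univ, iff_true]
    exact (crossingTime_mem_set hτ hφ (hp ξ)).1.2.trans hr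

theorem measurable_crossingLevel {Ω : Type*} [TopologicalSpace Ω] [MeasurableSpace Ω]
    [OpensMeasurableSpace Ω] {P : ℝ → Ω → ℝ} {X : Ω → ℝ} {a : ℝ} (hτ : 0 ≤ τ)
    (hφ : ContinuousOn φ (Icc 0 τ)) (hX : Measurable X)
    (hP : ContinuousOn (fun z : ℝ × Ω => P z.1 z.2) (Icc 0 τ ×ˢ univ)) :
    Measurable fun ξ => crossingLevel φ τ a (X ξ) fun t => P t ξ := by
  have hp : ∀ ξ, ContinuousOn (fun t => P t ξ) (Icc 0 τ) := fun ξ =>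
    hP.comp (by fun_prop : ContinuousOn (fun t : ℝ => (t, ξ)) (Icc 0 τ)) fun t ht => ⟨ht, trivial⟩
  refine Measurable.ite (measurableSet_le measurable_const (by fun_prop)) measurable_const ?_
  have h1 : Continuous (IccExtend hτ ((Icc 0 τ).domRestrict φ)) :=
    (continuousOn_iff_continuous_domRestrict.1 hφ).Icc_extend'
  convert h1.measurable.comp (measurable_crossingTime hτ hφ hP) with ξ
  simp [IccExtend_of_mem _ _ (crossingTime_mem_set hτ hφ (hp ξ)).1, domRestrict]

end Crossing

/-! ### The pointwise inequality for the multiplier. -/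

namespace IsOsgoodWeight

variable {σ : ℝ → ℝ} {M N τ : ℝ} {φ : ℝ → ℝ}

/-- Integrates the lower bound of `-φ'` over `[u, v]`. With one end at the crossing time, it says
that `|c - φ|` grows at least linearly in the distance to that time. -/
theorem mul_sub_le_sub (h : IsOsgoodWeight σ M N τ φ) (hσ : OsgoodModulus σ) (hM : 0 < M)
    (hN : 0 < N) {a X u v : ℝ} (ha : 0 < a) (ha1 : a ≤ 1) (hX : 0 < X) (hu : 0 ≤ u) (huv : u ≤ v)
    (hv : v ≤ τ) (hav : a * X ≤ φ v) :
    M * (a ^ 2 / 2 * (X ^ 2 * σ X⁻¹)) * (v - u) ≤ φ u - φ v := by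
  have hsub : Icc u v ⊆ Icc 0 τ := Icc_subset_Icc hu hv
  have key := Convex.image_sub_le_mul_sub_of_deriv_le (convex_Icc u v) (h.continuousOn.mono hsub)
    (fun t ht => (h.hasDerivAt
      (hsub (interior_subset ht))).differentiableAt.differentiableWithinAt)
    (C := -(M * (a ^ 2 / 2 * (X ^ 2 * σ X⁻¹)))) (fun t ht => by
      have ht := interior_subset ht
      rw [(h.hasDerivAt (hsub ht)).deriv, mul_assoc, neg_le_neg_iff]
      have := hσ.sq_mul_le ha ha1 hX
        (hav.trans (h.antitoneOn hσ hM hN (hsub ht) (hsub ⟨huv, le_rfl⟩) ht.2))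
      gcongr) u ⟨le_rfl, huv⟩ v ⟨huv, le_rfl⟩ huv
  linarith

end IsOsgoodWeight

/-- The pointwise inequality near the crossing time. -/
theorem multiplier_near {σ : ℝ → ℝ} (hσ : OsgoodModulus σ) {K L κ X d s q e δ : ℝ}
    (hX : 1 ≤ X) (hL : 0 ≤ L) (hκ : 0 ≤ κ) (hK : 4 * L + 4 * L ^ 2 * σ 1 + κ ≤ K)
    (hd : 0 ≤ d) (he : e ≤ 1)
    (hδ : K * (X ^ 2 * σ X⁻¹) ≤ δ) (hs : K * (X ^ 2 * σ X⁻¹) * d ≤ |s|)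
    (hpos : 0 < s → s - L * X * σ d ≤ q) (hneg : s < 0 → q ≤ s + L * X * σ d) :
    κ * X ≤ δ + 2 * s * q - e * s ^ 2 := by
  have hX0 : 0 < X := by linarith
  have hσX := hσ.pos (inv_pos.2 hX0)
  have hσ1 : σ X⁻¹ ≤ σ 1 := hσ.mono (inv_pos.2 hX0).le (inv_le_one_of_one_le₀ hX)
  have hXσ : X ≤ X ^ 2 * σ X⁻¹ := by
    have := mul_le_mul_of_nonneg_left (hσ.le (inv_pos.2 hX0).le) (sq_nonneg X)
    rwa [pow_two, mul_assoc, mul_inv_cancel₀ hX0.ne', mul_one, ← pow_two] at this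
  set D := L * X * σ d with hD
  have hσd : σ d ≤ (1 + d * X) * σ X⁻¹ := by
    have := subadditive_le_one_add_div_mul hσ.mono hσ.subadd (inv_pos.2 hX0) hd hσX.le
    rwa [div_inv_eq_mul] at this
  have hσ1' : 0 < σ 1 := hσ.pos one_pos
  have hD0 : 0 ≤ D := by
    have : 0 ≤ σ d := hd.trans (hσ.le hd)
    positivity
  have hDle : D ≤ L * X * ((1 + d * X) * σ X⁻¹) := by rw [hD]; gcongr
  -- `D` bounds the oscillation of the symbol between the current time and the crossing time;
  -- without it, `s * q ≥ s ^ 2`.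
  have hsq : 2 * s ^ 2 - 2 * |s| * D ≤ 2 * s * q := by
    rcases lt_trichotomy s 0 with h | h | h
    · rw [abs_of_neg h]; nlinarith [hneg h]
    · simp [h]
    · rw [abs_of_pos h]; nlinarith [hpos h]
  have hes : e * s ^ 2 ≤ s ^ 2 := by nlinarith [sq_nonneg s]
  have habs : s ^ 2 = |s| ^ 2 := (sq_abs s).symm
  set W := X ^ 2 * σ X⁻¹ with hW
  have hW0 : 0 < W := by positivity
  have hκW : κ * X ≤ κ * W := by gcongr
  -- Far from the crossing time on the scale `1 / X`, the linear growth of `|s|` gives `2 D ≤ |s|`,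
  -- so the square wins. Within that scale, completing the square costs `D ^ 2`, which is at most `4
  -- L² σ(1) W` and is paid by `δ`.
  rcases le_total 1 (d * X) with h1 | h1
  · have hDs : 2 * D ≤ |s| := by
      have h2 : D ≤ 2 * L * W * d := by
        refine hDle.trans ?_
        have : L * X * ((1 + d * X) * σ X⁻¹) ≤ L * X * ((d * X + d * X) * σ X⁻¹) := by gcongr
        refine this.trans (le_of_eq ?_)
        rw [hW]; ring
      have h3 : 4 * L * W * d ≤ K * W * d := by
        have : 4 * L ≤ K := by nlinarith [sq_nonneg L]
        gcongr
      linarith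
    have h4 : κ * W ≤ K * W := by
      have : κ ≤ K := by nlinarith [sq_nonneg L]
      gcongr
    nlinarith [abs_nonneg s]
  · have h2 : D ≤ 2 * L * X * σ X⁻¹ := by
      refine hDle.trans ?_
      have : L * X * ((1 + d * X) * σ X⁻¹) ≤ L * X * ((1 + 1) * σ X⁻¹) := by gcongr
      refine this.trans (le_of_eq ?_)
      ring
    have h3 : D ^ 2 ≤ 4 * L ^ 2 * σ 1 * W := by
      have h4 : D ^ 2 ≤ (2 * L * X * σ X⁻¹) ^ 2 := by gcongr
      refine h4.trans ?_
      have h5 : (2 * L * X * σ X⁻¹) ^ 2 = 4 * L ^ 2 * σ X⁻¹ * W := by rw [hW]; ring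
      rw [h5]
      gcongr
    have h6 : (4 * L + 4 * L ^ 2 * σ 1 + κ) * W ≤ K * W := by gcongr
    have h7 : 0 ≤ L * W := by positivity
    nlinarith [sq_nonneg (|s| - D)]

section Level

variable {σ : ℝ → ℝ} {M N τ a b L κ X : ℝ} {φ p : ℝ → ℝ}

theorem crossingLevel_bounds (hσ : OsgoodModulus σ) (h : IsOsgoodWeight σ M N τ φ) (hM : 0 < M)
    (hN : 0 < N) (hτ : 0 ≤ τ) (hp : ContinuousOn p (Icc 0 τ)) :
    0 ≤ crossingLevel φ τ a X p ∧ crossingLevel φ τ a X p ≤ 2 * φ 0 := by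
  have hm := (crossingTime_mem_set hτ h.continuousOn hp).1
  have h0 : N ≤ φ 0 := h.le ⟨le_rfl, hτ⟩
  unfold crossingLevel
  split_ifs
  · exact ⟨by linarith, le_rfl⟩
  · exact ⟨hN.le.trans (h.le hm), by
      linarith [h.antitoneOn hσ hM hN ⟨le_rfl, hτ⟩ hm hm.1]⟩

/-- Bounds the energy at the final time independently of `N`. A genuine crossing gives `c = φ t₀ ≤ p
t₀ ≤ b X`, the default crossing time gives `c = φ τ`, and at high frequencies `c = 2 φ 0 ≤ a X / 3`.
-/
theorem crossingLevel_sub_le (h : IsOsgoodWeight σ M N τ φ) (hN : 0 < N) (hτ : 0 ≤ τ)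
    (hX : 1 ≤ X) (ha1 : a ≤ 1) (hb : 1 ≤ b)
    (hp : ContinuousOn p (Icc 0 τ)) (hub : ∀ t ∈ Icc 0 τ, p t ≤ b * X) :
    crossingLevel φ τ a X p - φ τ ≤ b * X := by
  have hm := (crossingTime_mem_set hτ h.continuousOn hp).1
  have h0 : N ≤ φ 0 := h.le ⟨le_rfl, hτ⟩
  have h1 : N ≤ φ τ := h.le ⟨hτ, le_rfl⟩
  unfold crossingLevel
  split_ifs with hif
  · nlinarith
  · rcases hm.2.eq_or_lt with heq | hlt
    · rw [heq]; nlinarith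
    · linarith [le_of_crossingTime_lt hτ h.continuousOn hp hlt, hub _ hm]

/-- The pointwise inequality where the symbol and the multiplier dominate the weight. -/
theorem multiplier_far {a b κ N X q s e δ : ℝ} (hX : 1 ≤ X) (ha : 0 < a) (ha1 : a ≤ 1)
    (hδ : 0 ≤ δ) (he : e * (b * X) = a * X / 12) (he0 : 0 < e) (hN : 16 * κ ≤ a ^ 2 * N)
    (hNX : N ≤ a / 12 * X) (hlow : a / 12 * X ≤ s) (hup : s ≤ b * X)
    (hq : 5 * a / 12 * X ≤ q) : κ * X ≤ δ + 2 * s * q - e * s ^ 2 := by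
  have hX0 : 0 < X := by linarith
  have h2 : e * s ≤ e * (b * X) := by gcongr
  -- The term `2 * q` contributes at least `10 a X / 12`, and the choice of `e` limits `e * s` to `a
  -- X / 12`.
  have h1 : 9 * a / 12 * X ≤ 2 * q - e * s := by linarith
  have h2 : a / 12 * X * (9 * a / 12 * X) ≤ s * (2 * q - e * s) :=
    mul_le_mul hlow h1 (by positivity) ((by positivity : 0 ≤ a / 12 * X).trans hlow)
  have h3 : κ * X ≤ a / 12 * X * (9 * a / 12 * X) := by
    have h4 : 16 * κ ≤ a ^ 2 * (a / 12 * X) := hN.trans (by gcongr)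
    have h6 : a ^ 2 * (a / 12 * X) ≤ a ^ 2 * X := by
      gcongr
      exact mul_le_of_le_one_left hX0.le (by linarith)
    have h5 : κ ≤ a / 12 * (9 * a / 12 * X) := by
      rw [show a / 12 * (9 * a / 12 * X) = a ^ 2 * X / 16 by ring]
      linarith
    calc κ * X ≤ a / 12 * (9 * a / 12 * X) * X := by gcongr
      _ = _ := by ring
  linarith [show s * (2 * q - e * s) = 2 * s * q - e * s ^ 2 by ring]

/-- The pointwise inequality at high frequencies. -/
theorem multiplier_high {a b κ N X p f f0 e δ : ℝ} (hX : 1 ≤ X) (ha : 0 < a) (hδ : 0 ≤ δ)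
    (hb : 1 ≤ b) (ha1 : a ≤ 1) (he1 : e ≤ 1) (hN : 2 * b ≤ a * N)
    (hN' : 16 * κ ≤ a * N) (hN0 : 0 < N) (hf : N ≤ f) (hf0 : f ≤ f0) (hfX : 6 * f0 ≤ a * X)
    (hp : a * X - b ≤ p) :
    κ * X ≤ δ + 2 * (2 * f0 - f) * (p - f) - e * (2 * f0 - f) ^ 2 := by
  have haX : 0 < a * X := by positivity
  have hNf : a * N ≤ a * f0 := by gcongr; linarith
  have hbN : 2 * b ≤ f0 := by
    have : a * f0 ≤ f0 := mul_le_of_le_one_left (by linarith) ha1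
    linarith
  -- The losses `2b`, `2f` and `e (2 f0 - f)` total at most `5 f0`, below the threshold `6 f0 ≤ a
  -- X`; this leaves one of the two copies of `a X`.
  have h1 : a * X ≤ 2 * (p - f) - e * (2 * f0 - f) := by
    have : e * (2 * f0 - f) ≤ 1 * (2 * f0) := by
      gcongr <;> linarith
    linarith
  have h2 : f0 * (a * X) ≤ (2 * f0 - f) * (2 * (p - f) - e * (2 * f0 - f)) :=
    mul_le_mul (by linarith) h1 haX.le (by linarith)
  have h3 : κ * X ≤ f0 * (a * X) := by
    calc κ * X ≤ a * f0 * X := by gcongr; linarith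
      _ = _ := by ring
  linarith [show (2 * f0 - f) * (2 * (p - f) - e * (2 * f0 - f)) =
    2 * (2 * f0 - f) * (p - f) - e * (2 * f0 - f) ^ 2 by ring]

/-- Three regimes: at high frequencies `p` dominates all values of `φ`; near the crossing, `φ` stays
above `a X / 12` between `t` and `t₀` and its decay pays for the oscillation; after `φ` has fallen
below `a X / 12`, both `c - φ` and `p - φ` are of size `X`. -/
theorem multiplier_pointwise (hσ : OsgoodModulus σ) (h : IsOsgoodWeight σ M N τ φ) (hM0 : 0 < M)
    (hN0 : 0 < N) (hτ : 0 ≤ τ) (hX : 1 ≤ X) (ha : 0 < a) (ha1 : a ≤ 1) (hb : 1 ≤ b) (hL : 0 ≤ L)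
    (hκ : 0 ≤ κ) (hM : 4 * L + 4 * L ^ 2 * σ 1 + κ ≤ M * ((a / 12) ^ 2 / 2))
    (hN : 2 * b ≤ a * N) (hN' : 16 * κ ≤ a ^ 2 * N)
    (hp : ContinuousOn p (Icc 0 τ)) (hub : ∀ t ∈ Icc 0 τ, p t ≤ b * X)
    (hlb : ∀ t ∈ Icc 0 τ, a * X - b ≤ p t)
    (hosc : ∀ t ∈ Icc 0 τ, ∀ s ∈ Icc 0 τ, |p t - p s| ≤ L * X * σ |t - s|) {t : ℝ}
    (ht : t ∈ Icc 0 τ) :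
    κ * X ≤ M * φ t ^ 2 * σ (φ t)⁻¹ + 2 * (crossingLevel φ τ a X p - φ t) * (p t - φ t) -
      a / (12 * b) * (crossingLevel φ τ a X p - φ t) ^ 2 := by
  have hX0 : 0 < X := by linarith
  have h0mem : (0 : ℝ) ∈ Icc 0 τ := ⟨le_rfl, hτ⟩
  have hanti := h.antitoneOn hσ hM0 hN0
  have hNt := h.le ht
  have hN0' := h.le h0mem
  have hφ0t : φ t ≤ φ 0 := hanti h0mem ht ht.1
  have haX : 0 < a * X := by positivity
  have hd0 : 0 ≤ M * φ t ^ 2 * σ (φ t)⁻¹ := by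
    have := hσ.pos (inv_pos.2 (hN0.trans_le hNt)); positivity
  have he : a / (12 * b) ≤ 1 := by rw [div_le_one (by positivity)]; linarith
  have heb : a / (12 * b) * (b * X) = a * X / 12 := by field_simp
  have he0 : 0 < a / (12 * b) := by positivity
  set e := a / (12 * b) with hedef
  have haN : 16 * κ ≤ a * N := hN'.trans (by
    rw [pow_two, mul_assoc]; exact mul_le_of_le_one_left (by positivity) ha1)
  unfold crossingLevel
  split_ifs with hif
  · -- high frequencies
    exact multiplier_high hX ha hd0 hb ha1 he hN haN hN0 hNt hφ0t hif (hlb t ht)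
  · push Not at hif
    set t0 := crossingTime φ τ p with ht0
    have hm : t0 ∈ Icc 0 τ := (crossingTime_mem_set hτ h.continuousOn hp).1
    have hlt : t0 < τ → φ t0 ≤ p t0 := le_of_crossingTime_lt hτ h.continuousOn hp
    have hgt : 0 < t0 → p t0 ≤ φ t0 := le_of_crossingTime_pos hτ h.continuousOn hp
    have ha12 : 0 < a / 12 := by positivity
    have ha121 : a / 12 ≤ 1 := by linarith
    have hrew : M * φ t ^ 2 * σ (φ t)⁻¹ = M * (φ t ^ 2 * σ (φ t)⁻¹) := by ring
    -- A value of the weight below `a X / 12` forces `X` to be large compared with `N`, so that the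
    -- constant `b` is negligible.
    have hbig : ∀ y, N ≤ y → y < a / 12 * X → 2 * b ≤ a * X := fun y hy hyX => by
      have h1 : a * N ≤ a * (a / 12 * X) := by gcongr; exact hy.trans hyX.le
      have h2 : a * (a / 12 * X) ≤ a * X := by
        gcongr; exact mul_le_of_le_one_left hX0.le ha121
      linarith
    -- For `t0 = 0` this is the failure of the high-frequency condition; for `t0 > 0` the weight at
    -- `t0` is at least `p t0 ≥ a X - b ≥ a X / 2`.
    have hlevel : 2 * b ≤ a * X → a / 6 * X ≤ φ t0 := fun hbX => by
      rcases hm.1.eq_or_lt with heq | h0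
      · rw [← heq]; linarith
      · linarith [hgt h0, hlb t0 hm]
    rcases le_total t0 t with htt | htt
    · have hS : 0 ≤ φ t0 - φ t := sub_nonneg.2 (hanti hm ht htt)
      rcases le_or_gt (a / 12 * X) (φ t) with hc | hc
      · refine multiplier_near hσ hX hL hκ hM (sub_nonneg.2 htt) he ?_ ?_ ?_ ?_
        · rw [hrew, mul_assoc]
          have := hσ.sq_mul_le ha12 ha121 hX0 hc
          gcongr
        · rw [abs_of_nonneg hS, mul_assoc M]
          exact h.mul_sub_le_sub hσ hM0 hN0 ha12 ha121 hX0 hm.1 htt ht.2 hc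
        · intro hpos
          have hl : t0 < τ := by
            -- If `t0 = τ`, where there may be no crossing, then `t = t0` and `s = 0`.
            refine lt_of_le_of_ne hm.2 fun heq => ?_
            rw [le_antisymm (ht.2.trans heq.ge) htt, sub_self] at hpos
            exact hpos.false
          have := hosc t ht t0 hm
          rw [abs_of_nonneg (sub_nonneg.2 htt)] at this
          linarith [neg_abs_le (p t - p t0), hlt hl]
        · exact fun hneg => absurd hS hneg.not_ge
      · have hbX := hbig _ hNt hc
        have hl := hlevel hbX
        have hlt' : t0 < τ := by
          refine lt_of_le_of_ne hm.2 fun heq => ?_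
          have hteq : t = t0 := le_antisymm (ht.2.trans heq.ge) htt
          rw [hteq] at hc; linarith
        have hup : φ t0 - φ t ≤ b * X := by linarith [hlt hlt', hub t0 hm]
        have hlow : a / 12 * X ≤ φ t0 - φ t := by linarith
        exact multiplier_far hX ha ha1 hd0 heb he0 hN' (hNt.trans hc.le) hlow hup
          (by linarith [hlb t ht])
    · have hS : φ t0 - φ t ≤ 0 := sub_nonpos.2 (hanti ht hm htt)
      -- Before the crossing the smallest relevant value of the weight is `φ t0`, so the far regime
      -- does not occur.
      have hc : a / 12 * X ≤ φ t0 := by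
        rcases le_or_gt (a / 12 * X) (φ t0) with hc | hc
        · exact hc
        · linarith [hlevel (hbig _ (h.le hm) hc)]
      refine multiplier_near hσ hX hL hκ hM (sub_nonneg.2 htt) he ?_ ?_ ?_ ?_
      · rw [hrew, mul_assoc]
        have := hσ.sq_mul_le ha12 ha121 hX0 (hc.trans (hanti ht hm htt))
        gcongr
      · rw [abs_of_nonpos hS, neg_sub, mul_assoc M]
        exact h.mul_sub_le_sub hσ hM0 hN0 ha12 ha121 hX0 ht.1 htt hm.2 hc
      · exact fun hpos => absurd hS hpos.not_ge
      · intro hneg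
        have h0 : 0 < t0 := by
          refine lt_of_le_of_ne hm.1 fun heq => ?_
          rw [le_antisymm (htt.trans heq.ge) ht.1, ← heq, sub_self] at hneg
          exact hneg.false
        have := hosc t0 hm t ht
        rw [abs_of_nonneg (sub_nonneg.2 htt)] at this
        linarith [neg_abs_le (p t0 - p t), hgt h0]

end Level

/-! ### The Fourier side -/

/-- Both sides are locally integrable and agree against compactly supported smooth functions. -/
theorem ae_eq_mul_of_smulLeftCLM_eq {n : ℕ} {g : EuclideanSpace ℝ (Fin n) → ℂ}
    (hg : g.HasTemperateGrowth) {f h : L2 n}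
    (hfh : TemperedDistribution.smulLeftCLM ℂ g (f : 𝓢'(EuclideanSpace ℝ (Fin n), ℂ)) =
      (h : 𝓢'(EuclideanSpace ℝ (Fin n), ℂ))) :
    (h : EuclideanSpace ℝ (Fin n) → ℂ) =ᵐ[volume] fun ξ => g ξ * f ξ := by
  have hgc : Continuous g := hg.1.continuous
  have hh : LocallyIntegrable (h : EuclideanSpace ℝ (Fin n) → ℂ) :=
    (Lp.memLp h).locallyIntegrable one_le_two
  have hf : LocallyIntegrable (fun ξ => g ξ * f ξ) := by
    have := ((Lp.memLp f).locallyIntegrable one_le_two).locallyIntegrableOn univ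
    simpa [locallyIntegrableOn_univ] using
      this.continuousOn_mul hgc.continuousOn isOpen_univ.isLocallyClosed
  have key := ae_eq_zero_of_integral_contDiff_smul_eq_zero (hh.sub hf) fun ψ hψ hψc => by
    have hψ₁ : HasCompactSupport (Complex.ofRealCLM ∘ ψ) := hψc.comp_left rfl
    have hψ₂ : ContDiff ℝ ∞ (Complex.ofRealCLM ∘ ψ) := by fun_prop
    have h1 := congrArg (fun S : 𝓢'(EuclideanSpace ℝ (Fin n), ℂ) => S (hψ₁.toSchwartzMap hψ₂)) hfh
    simp only [TemperedDistribution.smulLeftCLM_apply_apply, Lp.toTemperedDistribution_apply,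
      SchwartzMap.smulLeftCLM_apply_apply hg] at h1
    have i1 : Integrable fun x => ψ x • h x :=
      hh.integrable_smul_left_of_hasCompactSupport hψ.continuous hψc
    have i2 : Integrable fun x => ψ x • (g x * f x) :=
      hf.integrable_smul_left_of_hasCompactSupport hψ.continuous hψc
    have : ∀ x, ψ x • (h - fun ξ => g ξ * f ξ : EuclideanSpace ℝ (Fin n) → ℂ) x =
        ψ x • h x - ψ x • (g x * f x) := fun x => smul_sub _ _ _
    simp_rw [this]
    have e1 : ∫ x, ψ x • h x = ∫ x, (hψ₁.toSchwartzMap hψ₂) x • h x :=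
      integral_congr_ae (.of_forall fun x => (Complex.coe_smul (ψ x) (h x)).symm)
    have e2 : ∫ x, ψ x • (g x * f x) = ∫ x, (g x • (hψ₁.toSchwartzMap hψ₂) x) • f x :=
      integral_congr_ae (.of_forall fun x => by
        change ψ x • (g x * f x) = (g x * (ψ x : ℂ)) * f x
        rw [Complex.real_smul]; ring)
    rw [integral_sub i1 i2, e1, e2, h1, sub_self]
  filter_upwards [key] with ξ hξ
  exact sub_eq_zero.1 hξ

/-- The symbol `∏ᵢ (2πi ξᵢ)^{αᵢ}` of `∂ₓ^α`. -/
noncomputable def derivSymbol {n : ℕ} (α : Fin n → ℕ) (ξ : EuclideanSpace ℝ (Fin n)) : ℂ :=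
  ∏ i, (2 * Real.pi * Complex.I * ξ i) ^ α i

theorem hasTemperateGrowth_coord {n : ℕ} (i : Fin n) :
    (fun ξ : EuclideanSpace ℝ (Fin n) => (ξ i : ℂ)).HasTemperateGrowth :=
  (Complex.ofRealCLM ∘L (EuclideanSpace.proj i :
    EuclideanSpace ℝ (Fin n) →L[ℝ] ℝ)).hasTemperateGrowth

theorem fourier_lineDeriv_single {n : ℕ} (i : Fin n) (S : 𝓢'(EuclideanSpace ℝ (Fin n), ℂ)) :
    𝓕 (∂_{(EuclideanSpace.single i (1 : ℝ))} S) =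
      TemperedDistribution.smulLeftCLM ℂ (fun ξ => 2 * Real.pi * Complex.I * ξ i) (𝓕 S) := by
  rw [TemperedDistribution.fourier_lineDerivOp_eq]
  have h := TemperedDistribution.smulLeftCLM_smul (F := ℂ) (hasTemperateGrowth_coord i)
    (2 * Real.pi * Complex.I)
  have h2 : (fun ξ : EuclideanSpace ℝ (Fin n) => 2 * Real.pi * Complex.I * (ξ i : ℂ)) =
      (2 * Real.pi * Complex.I : ℂ) • fun ξ : EuclideanSpace ℝ (Fin n) => (ξ i : ℂ) := rfl
  rw [h2, h]
  simp [EuclideanSpace.inner_single_right]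

theorem hasTemperateGrowth_two_pi_I_coord {n : ℕ} (i : Fin n) :
    (fun ξ : EuclideanSpace ℝ (Fin n) => 2 * Real.pi * Complex.I * (ξ i : ℂ)).HasTemperateGrowth :=
  (Function.HasTemperateGrowth.const _).mul (hasTemperateGrowth_coord i)

/-- Temperate growth of the partial product is carried through the induction because composing the
multiplications requires it. -/
theorem fourier_multiDeriv_list {n : ℕ} (α : Fin n → ℕ) (S : 𝓢'(EuclideanSpace ℝ (Fin n), ℂ))
    (l : List (Fin n)) :
    (fun ξ : EuclideanSpace ℝ (Fin n) =>
      (l.map fun i => (2 * Real.pi * Complex.I * (ξ i : ℂ)) ^ α i).prod).HasTemperateGrowth ∧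
    𝓕 (l.foldr (fun i g => (fun h : 𝓢'(EuclideanSpace ℝ (Fin n), ℂ) =>
      ∂_{(EuclideanSpace.single i (1 : ℝ))} h)^[α i] g) S) =
    TemperedDistribution.smulLeftCLM ℂ (fun ξ : EuclideanSpace ℝ (Fin n) =>
      (l.map fun i => (2 * Real.pi * Complex.I * (ξ i : ℂ)) ^ α i).prod) (𝓕 S) := by
  have pow : ∀ (i : Fin n) (k : ℕ), (fun ξ : EuclideanSpace ℝ (Fin n) =>
      (2 * Real.pi * Complex.I * (ξ i : ℂ)) ^ k).HasTemperateGrowth := fun i k =>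
    (hasTemperateGrowth_two_pi_I_coord i).pow k
  have iter : ∀ (i : Fin n) (k : ℕ) (S : 𝓢'(EuclideanSpace ℝ (Fin n), ℂ)),
      𝓕 ((fun h : 𝓢'(EuclideanSpace ℝ (Fin n), ℂ) =>
        ∂_{(EuclideanSpace.single i (1 : ℝ))} h)^[k] S) =
      TemperedDistribution.smulLeftCLM ℂ
        (fun ξ : EuclideanSpace ℝ (Fin n) => (2 * Real.pi * Complex.I * (ξ i : ℂ)) ^ k) (𝓕 S) := by
    intro i k
    induction k with
    | zero => intro S; simp
    | succ k ih =>
      intro S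
      rw [Function.iterate_succ_apply', fourier_lineDeriv_single, ih,
        TemperedDistribution.smulLeftCLM_smulLeftCLM_apply (pow i k)
          (hasTemperateGrowth_two_pi_I_coord i)]
      simp only [pow_succ]
      rfl
  induction l with
  | nil => simp [Function.HasTemperateGrowth.const]
  | cons i l ih =>
    have hi := pow i (α i)
    refine ⟨?_, ?_⟩
    · simp only [List.map_cons, List.prod_cons]
      exact hi.mul ih.1
    · rw [List.foldr_cons, iter, ih.2,
        TemperedDistribution.smulLeftCLM_smulLeftCLM_apply ih.1 hi, mul_comm]
      congr 1

theorem IsWeakDeriv.fourier_ae_eq {n : ℕ} {α : Fin n → ℕ} {f g : L2 n} (h : IsWeakDeriv α f g) :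
    (𝓕 g : L2 n) =ᵐ[volume] fun ξ => derivSymbol α ξ * (𝓕 f : L2 n) ξ := by
  obtain ⟨h1, h2⟩ := fourier_multiDeriv_list α (f : 𝓢'(EuclideanSpace ℝ (Fin n), ℂ))
    (List.finRange n)
  have h3 : 𝓕 (multiDeriv α (f : 𝓢'(EuclideanSpace ℝ (Fin n), ℂ))) =
      𝓕 (g : 𝓢'(EuclideanSpace ℝ (Fin n), ℂ)) := congrArg _ h
  rw [multiDeriv, h2, Lp.fourier_toTemperedDistribution_eq,
    Lp.fourier_toTemperedDistribution_eq] at h3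
  filter_upwards [ae_eq_mul_of_smulLeftCLM_eq h1 h3] with ξ hξ
  rw [hξ, derivSymbol, Fin.prod_univ_def]

theorem MemH.isWeakDeriv {n k : ℕ} {f : L2 n} (h : MemH k f) {α : Fin n → ℕ}
    (hα : α ∈ multiIndices n k) : IsWeakDeriv α f (weakDeriv α f) := by
  rw [weakDeriv, dif_pos (h α hα)]
  exact (h α hα).choose_spec

/-- The real symbol `∑_α (-1)^{|α|} ρ_α (2πξ)^α` of the spatial operator. -/
noncomputable def operatorSymbol {n N : ℕ} (r : EuclideanSpace ℝ (multiIndices n N))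
    (ξ : EuclideanSpace ℝ (Fin n)) : ℝ :=
  ∑ α : multiIndices n N, (-1) ^ weight α.1 * r α * ∏ i, (2 * Real.pi * ξ i) ^ α.1 i

/-- The coefficient `i^{|α|}` meets the `i^{|α|}` of the derivative, so the symbol of the spatial
operator is real. -/
theorem I_pow_mul_derivSymbol {n : ℕ} (α : Fin n → ℕ) (ξ : EuclideanSpace ℝ (Fin n)) :
    Complex.I ^ weight α * derivSymbol α ξ =
      (((-1) ^ weight α * ∏ i, (2 * Real.pi * ξ i) ^ α i : ℝ) : ℂ) := by
  have : derivSymbol α ξ = Complex.I ^ weight α * ∏ i, ((2 * Real.pi * ξ i : ℝ) : ℂ) ^ α i := by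
    rw [derivSymbol, weight, ← Finset.prod_pow_eq_pow_sum, ← Finset.prod_mul_distrib]
    refine Finset.prod_congr rfl fun i _ => ?_
    rw [← mul_pow]; push_cast; ring
  rw [this, ← mul_assoc, ← mul_pow, Complex.I_mul_I]
  push_cast
  rfl

theorem norm_derivSymbol {n : ℕ} (α : Fin n → ℕ) (ξ : EuclideanSpace ℝ (Fin n)) :
    ‖derivSymbol α ξ‖ = |∏ i, (2 * Real.pi * ξ i) ^ α i| := by
  have := congrArg norm (I_pow_mul_derivSymbol α ξ)
  rw [norm_mul, norm_pow, Complex.norm_I, one_pow, one_mul, Complex.norm_real, Real.norm_eq_abs,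
    abs_mul, abs_pow, abs_neg, abs_one, one_pow, one_mul] at this
  exact this

theorem MemH.fourier_spatialOp {n N : ℕ} {f : L2 n} (h : MemH N f)
    (r : EuclideanSpace ℝ (multiIndices n N)) :
    (𝓕 (spatialOp r f) : L2 n) =ᵐ[volume] fun ξ => (operatorSymbol r ξ : ℂ) * (𝓕 f : L2 n) ξ := by
  have h1 : (𝓕 (spatialOp r f) : L2 n) =
      ∑ α : multiIndices n N, (Complex.I ^ weight α.1 * (r α : ℂ)) • 𝓕 (weakDeriv α.1 f) := by
    have := map_sum (Lp.fourierTransformₗᵢ (EuclideanSpace ℝ (Fin n)) ℂ)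
      (fun α : multiIndices n N => (Complex.I ^ weight α.1 * (r α : ℂ)) • weakDeriv α.1 f)
      Finset.univ
    simp only [map_smul] at this
    exact this
  rw [h1]
  have h2 : ∀ α : multiIndices n N, ∀ᵐ ξ, (((Complex.I ^ weight α.1 * (r α : ℂ)) •
      𝓕 (weakDeriv α.1 f) : L2 n) : EuclideanSpace ℝ (Fin n) → ℂ) ξ =
      Complex.I ^ weight α.1 * r α * (derivSymbol α.1 ξ * (𝓕 f : L2 n) ξ) := fun α => by
    filter_upwards [Lp.coeFn_smul (Complex.I ^ weight α.1 * (r α : ℂ)) (𝓕 (weakDeriv α.1 f) : L2 n),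
      (h.isWeakDeriv α.2).fourier_ae_eq] with ξ h3 h4
    rw [h3, Pi.smul_apply, h4, smul_eq_mul]
  filter_upwards [Lp.coeFn_finsetSum Finset.univ fun α : multiIndices n N =>
    ((Complex.I ^ weight α.1 * (r α : ℂ)) • 𝓕 (weakDeriv α.1 f) : L2 n), ae_all_iff.2 h2] with ξ h3 h4
  rw [h3, operatorSymbol, Complex.ofReal_sum, Finset.sum_mul, Finset.sum_apply]
  refine Finset.sum_congr rfl fun α _ => ?_
  rw [h4 α]
  have := I_pow_mul_derivSymbol α.1 ξ
  calc Complex.I ^ weight α.1 * r α * (derivSymbol α.1 ξ * (𝓕 f : L2 n) ξ)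
      = r α * (Complex.I ^ weight α.1 * derivSymbol α.1 ξ) * (𝓕 f : L2 n) ξ := by ring
    _ = _ := by rw [this]; push_cast; ring

/-! ### Growth, oscillation and ellipticity of the symbol. -/

/-- The weight `1 + |2πξ|^{2m}`, comparable to the square of the symbol of the norm of `H^m`. -/
noncomputable def sobolevWeight {n : ℕ} (m : ℕ) (ξ : EuclideanSpace ℝ (Fin n)) : ℝ :=
  1 + (2 * Real.pi * ‖ξ‖) ^ (2 * m)

theorem one_le_sobolevWeight {n : ℕ} (m : ℕ) (ξ : EuclideanSpace ℝ (Fin n)) :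
    1 ≤ sobolevWeight m ξ := by
  unfold sobolevWeight
  have : 0 ≤ (2 * Real.pi * ‖ξ‖) ^ (2 * m) := by positivity
  linarith

theorem continuous_sobolevWeight {n : ℕ} (m : ℕ) :
    Continuous (sobolevWeight m : EuclideanSpace ℝ (Fin n) → ℝ) := by
  unfold sobolevWeight
  fun_prop

theorem pow_le_one_add_pow {y : ℝ} (hy : 0 ≤ y) {k l : ℕ} (h : k ≤ l) : y ^ k ≤ 1 + y ^ l := by
  rcases le_total y 1 with h1 | h1
  · exact (pow_le_one₀ hy h1).trans (le_add_of_nonneg_right (by positivity))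
  · exact (pow_le_pow_right₀ h1 h).trans (by linarith)

theorem abs_monomial_le {n : ℕ} (α : Fin n → ℕ) (ξ : EuclideanSpace ℝ (Fin n)) :
    |∏ i, (2 * Real.pi * ξ i) ^ α i| ≤ (2 * Real.pi * ‖ξ‖) ^ weight α := by
  rw [Finset.abs_prod, weight, ← Finset.prod_pow_eq_pow_sum]
  refine Finset.prod_le_prod (fun i _ => abs_nonneg _) fun i _ => ?_
  rw [abs_pow, abs_mul, abs_of_pos (by positivity : 0 < 2 * Real.pi)]
  gcongr
  exact PiLp.norm_apply_le ξ i

theorem continuous_operatorSymbol {n N : ℕ} :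
    Continuous fun z : EuclideanSpace ℝ (multiIndices n N) × EuclideanSpace ℝ (Fin n) =>
      operatorSymbol z.1 z.2 := by
  unfold operatorSymbol
  fun_prop

theorem operatorSymbol_sub {n N : ℕ} (r s : EuclideanSpace ℝ (multiIndices n N))
    (ξ : EuclideanSpace ℝ (Fin n)) :
    operatorSymbol (r - s) ξ = operatorSymbol r ξ - operatorSymbol s ξ := by
  simp only [operatorSymbol, PiLp.sub_apply, ← Finset.sum_sub_distrib]
  exact Finset.sum_congr rfl fun α _ => by ring

theorem abs_operatorSymbol_le {n m : ℕ} (r : EuclideanSpace ℝ (multiIndices n (2 * m)))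
    (ξ : EuclideanSpace ℝ (Fin n)) :
    |operatorSymbol r ξ| ≤ (multiIndices n (2 * m)).card * ‖r‖ * sobolevWeight m ξ := by
  refine (Finset.abs_sum_le_sum_abs _ _).trans ?_
  refine (Finset.sum_le_card_nsmul _ _ (‖r‖ * sobolevWeight m ξ) fun α _ => ?_).trans
    (le_of_eq ?_)
  · rw [abs_mul, abs_mul, abs_pow, abs_neg, abs_one, one_pow, one_mul]
    gcongr
    · exact PiLp.norm_apply_le r α
    · exact (abs_monomial_le _ _).trans
        (pow_le_one_add_pow (by positivity) (mem_multiIndices.1 α.2))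
  · simp [mul_assoc]

theorem operatorSymbol_eq_sum {n N : ℕ} (r : EuclideanSpace ℝ (multiIndices n N))
    {ξ : EuclideanSpace ℝ (Fin n)} (hξ : ξ ≠ 0) :
    operatorSymbol r ξ = ∑ k ∈ Finset.range (N + 1),
      homogeneousSymbol r k ((2 * Real.pi) • ξ) * (2 * Real.pi * ‖ξ‖) ^ k := by
  have hnorm : ‖(2 * Real.pi) • ξ‖ = 2 * Real.pi * ‖ξ‖ := by
    rw [norm_smul, Real.norm_of_nonneg (by positivity)]
  have hpos : 0 < 2 * Real.pi * ‖ξ‖ := by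
    have := norm_pos_iff.2 hξ; positivity
  unfold operatorSymbol
  rw [← Finset.sum_fiberwise_of_maps_to (t := Finset.range (N + 1)) (g := fun α => weight α.1)
    fun α _ => Finset.mem_range_succ_iff.2 (mem_multiIndices.1 α.2)]
  refine Finset.sum_congr rfl fun k _ => ?_
  rw [homogeneousSymbol, hnorm, div_mul_cancel₀ _ (pow_pos hpos k).ne', Finset.mul_sum]
  refine Finset.sum_congr rfl fun α hα => ?_
  rw [(Finset.mem_filter.1 hα).2, mul_assoc]
  simp [mul_assoc]

/-- Gårding-type lower bound of a sum of homogeneous terms. -/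
theorem sum_homogeneous_lower_bound {Λ : ℝ} (hΛ : 0 < Λ) (m : ℕ) :
    ∃ b : ℝ, ∀ (y : ℝ) (c : ℕ → ℝ), 0 ≤ y → (∀ k < 2 * m, |c k| ≤ Λ) → 1 / Λ ≤ c (2 * m) →
      y ^ (2 * m) / (2 * Λ) - b ≤ ∑ k ∈ Finset.range (2 * m + 1), c k * y ^ k := by
  -- For `y ≥ Y` each lower power is at most `y ^ (2m) / Y`, and `2m` such terms with coefficient
  -- `Λ` use up at most half of the ellipticity `1 / Λ`.
  set Y : ℝ := 4 * m * Λ ^ 2 + 1 with hY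
  have hY1 : 1 ≤ Y := by rw [hY]; linarith [show 0 ≤ 4 * (m : ℝ) * Λ ^ 2 by positivity]
  refine ⟨2 * m * (Λ * Y ^ (2 * m)), fun y c hy hc hc' => ?_⟩
  have hterm : ∀ k < 2 * m, y ^ k ≤ Y ^ (2 * m) + y ^ (2 * m) / Y := fun k hk => by
    rcases le_total y Y with h | h
    · have h1 : y ^ k ≤ Y ^ k := by gcongr
      have h2 : Y ^ k ≤ Y ^ (2 * m) := pow_le_pow_right₀ hY1 hk.le
      have h3 : 0 ≤ y ^ (2 * m) / Y := by positivity
      linarith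
    · have h1 : y ^ k * Y ≤ y ^ (2 * m) := by
        calc y ^ k * Y ≤ y ^ k * y := by gcongr
          _ = y ^ (k + 1) := (pow_succ _ _).symm
          _ ≤ y ^ (2 * m) := pow_le_pow_right₀ (hY1.trans h) hk
      have h2 : y ^ k ≤ y ^ (2 * m) / Y := by rwa [le_div_iff₀ (by linarith)]
      have h3 : 0 ≤ Y ^ (2 * m) := by positivity
      linarith
  have hsum : -(2 * m * (Λ * (Y ^ (2 * m) + y ^ (2 * m) / Y))) ≤
      ∑ k ∈ Finset.range (2 * m), c k * y ^ k := by
    have : ∑ _k ∈ Finset.range (2 * m), -(Λ * (Y ^ (2 * m) + y ^ (2 * m) / Y)) ≤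
        ∑ k ∈ Finset.range (2 * m), c k * y ^ k := Finset.sum_le_sum fun k hk => by
      have hk := Finset.mem_range.1 hk
      have h1 : |c k * y ^ k| ≤ Λ * (Y ^ (2 * m) + y ^ (2 * m) / Y) := by
        rw [abs_mul, abs_of_nonneg (by positivity : 0 ≤ y ^ k)]
        exact mul_le_mul (hc k hk) (hterm k hk) (by positivity) hΛ.le
      linarith [neg_abs_le (c k * y ^ k)]
    simpa using this
  have htop : 1 / Λ * y ^ (2 * m) ≤ c (2 * m) * y ^ (2 * m) := by gcongr
  have habsorb : 2 * m * (Λ * (y ^ (2 * m) / Y)) ≤ y ^ (2 * m) / (2 * Λ) := by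
    rw [le_div_iff₀ (by positivity)]
    have h1 : 2 * m * (Λ * (y ^ (2 * m) / Y)) * (2 * Λ) =
        y ^ (2 * m) * (4 * m * Λ ^ 2 / Y) := by ring
    rw [h1]
    refine mul_le_of_le_one_right (by positivity) ?_
    rw [div_le_one (by linarith)]
    linarith
  have hhalf : 1 / Λ * y ^ (2 * m) = y ^ (2 * m) / (2 * Λ) + y ^ (2 * m) / (2 * Λ) := by
    field_simp; ring
  rw [Finset.sum_range_succ]
  linarith

theorem operatorSymbol_lower_bound {n m : ℕ} {Λ : ℝ} (hΛ : 0 < Λ) :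
    ∃ a b : ℝ, 0 < a ∧ a ≤ 1 ∧ ∀ (r : EuclideanSpace ℝ (multiIndices n (2 * m)))
      (ξ : EuclideanSpace ℝ (Fin n)), ξ ≠ 0 →
      (∀ η : EuclideanSpace ℝ (Fin n), η ≠ 0 → (∀ k < 2 * m, |homogeneousSymbol r k η| ≤ Λ) ∧
        1 / Λ ≤ homogeneousSymbol r (2 * m) η) →
      a * sobolevWeight m ξ - b ≤ operatorSymbol r ξ := by
  obtain ⟨b, hb⟩ := sum_homogeneous_lower_bound hΛ m
  -- The extra `1` in `b + 1` absorbs the constant term of the weight, as `a ≤ 1`.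
  refine ⟨min (1 / (2 * Λ)) 1, b + 1, lt_min (by positivity) one_pos, min_le_right _ _,
    fun r ξ hξ h => ?_⟩
  obtain ⟨h1, h2⟩ := h ((2 * Real.pi) • ξ) (smul_ne_zero (by positivity) hξ)
  have h3 := hb (2 * Real.pi * ‖ξ‖) (fun k => homogeneousSymbol r k ((2 * Real.pi) • ξ))
    (by positivity) h1 h2
  rw [operatorSymbol_eq_sum r hξ]
  refine le_trans ?_ h3
  have h4 : min (1 / (2 * Λ)) 1 * (2 * Real.pi * ‖ξ‖) ^ (2 * m) ≤
      1 / (2 * Λ) * (2 * Real.pi * ‖ξ‖) ^ (2 * m) := by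
    gcongr; exact min_le_left _ _
  have h5 : (2 * Real.pi * ‖ξ‖) ^ (2 * m) / (2 * Λ) =
      1 / (2 * Λ) * (2 * Real.pi * ‖ξ‖) ^ (2 * m) := by ring
  rw [sobolevWeight, h5]
  linarith [min_le_right (1 / (2 * Λ)) 1]

/-! ### Plancherel and the norm of `H^m`. -/

theorem L2_norm_sq_eq_integral {n : ℕ} (f : L2 n) : ‖f‖ ^ 2 = ∫ ξ, ‖f ξ‖ ^ 2 := by
  have := L2.inner_def (𝕜 := ℂ) f f
  have h2 : (inner ℂ f f).re = ‖f‖ ^ 2 := inner_self_eq_norm_sq (𝕜 := ℂ) f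
  rw [← h2, this, ← Complex.reCLM_apply, ← ContinuousLinearMap.integral_comp_comm _
    (L2.integrable_inner f f)]
  exact integral_congr_ae (.of_forall fun ξ => inner_self_eq_norm_sq (𝕜 := ℂ) (f ξ))

theorem L2_integrable_norm_sq {n : ℕ} (f : L2 n) : Integrable fun ξ => ‖f ξ‖ ^ 2 :=
  (memLp_two_iff_integrable_sq_norm (Lp.memLp f).1).1 (Lp.memLp f)

theorem normH_sq_le {n m : ℕ} {f : L2 n} (h : MemH m f)
    (hint : Integrable fun ξ => sobolevWeight m ξ * ‖(𝓕 f : L2 n) ξ‖ ^ 2) :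
    normH m f ^ 2 ≤
      (multiIndices n m).card * ∫ ξ, sobolevWeight m ξ * ‖(𝓕 f : L2 n) ξ‖ ^ 2 := by
  rw [normH, Real.sq_sqrt (by positivity), ← nsmul_eq_mul]
  refine Finset.sum_le_card_nsmul _ _ _ fun α hα => ?_
  rw [← Lp.norm_fourier_eq, L2_norm_sq_eq_integral]
  refine integral_mono_ae (L2_integrable_norm_sq _) hint ?_
  filter_upwards [(h.isWeakDeriv hα).fourier_ae_eq] with ξ hξ
  rw [hξ, norm_mul, mul_pow, norm_derivSymbol]
  gcongr
  calc |∏ i, (2 * Real.pi * ξ i) ^ α i| ^ 2 ≤ ((2 * Real.pi * ‖ξ‖) ^ weight α) ^ 2 := by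
        gcongr; exact abs_monomial_le _ _
    _ = (2 * Real.pi * ‖ξ‖) ^ (weight α * 2) := (pow_mul _ _ _).symm
    _ ≤ _ := pow_le_one_add_pow (by positivity) (by have := mem_multiIndices.1 hα; omega)

/-! ### Absolutely continuous curves -/

theorem absolutelyContinuousOnInterval_of_norm_sub_le {F : Type*} [NormedAddCommGroup F]
    {f : ℝ → F} {g : ℝ → ℝ} {a b : ℝ} (hab : a ≤ b) (hg : IntervalIntegrable g volume a b)
    (h : ∀ s t, a ≤ s → s ≤ t → t ≤ b → ‖f t - f s‖ ≤ ∫ x in s..t, g x) :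
    AbsolutelyContinuousOnInterval f a b := by
  have hac := hg.absolutelyContinuousOnInterval_intervalIntegral (c := a) left_mem_uIcc
  have key : ∀ s ∈ uIcc a b, ∀ t ∈ uIcc a b,
      dist (f s) (f t) ≤ dist (∫ x in a..s, g x) (∫ x in a..t, g x) := by
    have hle : ∀ s t, a ≤ s → s ≤ t → t ≤ b →
        dist (f s) (f t) ≤ dist (∫ x in a..s, g x) (∫ x in a..t, g x) := by
      intro s t has hst htb
      have hi : ∀ x, a ≤ x → x ≤ b → IntervalIntegrable g volume a x := fun x hx hx' =>
        hg.mono_set (by rw [uIcc_of_le hx, uIcc_of_le hab]; exact Icc_subset_Icc_right hx')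
      rw [dist_comm, dist_eq_norm, dist_comm, Real.dist_eq,
        intervalIntegral.integral_interval_sub_left (hi t (has.trans hst) htb)
          (hi s has (hst.trans htb))]
      exact (h s t has hst htb).trans (le_abs_self _)
    intro s hs t ht
    rw [uIcc_of_le hab] at hs ht
    rcases le_total s t with hst | hst
    · exact hle s t hs.1 hst ht.2
    · rw [dist_comm (f s), dist_comm (∫ x in a..s, g x)]
      exact hle t s ht.1 hst hs.2
  rw [absolutelyContinuousOnInterval_iff] at hac ⊢
  intro ε hε
  obtain ⟨δ, hδ, hE⟩ := hac ε hε
  refine ⟨δ, hδ, fun E hE' hlt => (Finset.sum_le_sum fun i hi => ?_).trans_lt (hE E hE' hlt)⟩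
  have := hE'.1 i hi
  exact key _ this.1 _ this.2

theorem IntervalIntegrable.absolutelyContinuousOnInterval_integral {F : Type*}
    [NormedAddCommGroup F] [NormedSpace ℝ F] {f : ℝ → F} {a b : ℝ} (hab : a ≤ b)
    (hf : IntervalIntegrable f volume a b) :
    AbsolutelyContinuousOnInterval (fun x => ∫ s in a..x, f s) a b := by
  refine absolutelyContinuousOnInterval_of_norm_sub_le hab hf.norm fun s t has hst htb => ?_
  have hi : ∀ x, a ≤ x → x ≤ b → IntervalIntegrable f volume a x := fun x hx hx' =>
    hf.mono_set (by rw [uIcc_of_le hx, uIcc_of_le hab]; exact Icc_subset_Icc_right hx')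
  rw [intervalIntegral.integral_interval_sub_left (hi t (has.trans hst) htb)
    (hi s has (hst.trans htb))]
  exact intervalIntegral.norm_integral_le_integral_norm hst

/-- The difference of `f` and the primitive of `f'` is absolutely continuous with zero derivative
almost everywhere, hence constant. -/
theorem AbsolutelyContinuousOnInterval.integral_eq_sub_of_ae_hasDerivAt {F : Type*}
    [NormedAddCommGroup F] [NormedSpace ℝ F] [CompleteSpace F] {f f' : ℝ → F} {a b : ℝ}
    (hab : a ≤ b) (hf : AbsolutelyContinuousOnInterval f a b)
    (hf' : IntervalIntegrable f' volume a b)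
    (h : ∀ᵐ x, x ∈ Icc a b → HasDerivAt f (f' x) x) : ∫ x in a..b, f' x = f b - f a := by
  have hac := hf'.absolutelyContinuousOnInterval_integral hab
  obtain ⟨C, hC⟩ := (hf.sub hac).const_of_ae_hasDerivAt_zero (by
    filter_upwards [h, hf'.ae_hasDerivAt_integral] with x h1 h2 hx
    have := (h1 (by rwa [uIcc_of_le hab] at hx)).sub (h2 hx a left_mem_uIcc)
    rwa [sub_self] at this)
  have ha := hC a left_mem_uIcc
  have hb := hC b right_mem_uIcc
  simp only [Pi.sub_apply, intervalIntegral.integral_same, sub_zero] at ha hb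
  rw [ha, ← hb]; abel

/-! ### Weak time derivatives and the continuous representative. -/

/-- If every test function with vanishing integral annihilates `g`, then `g` is constant. -/
theorem ae_eq_const_of_integral_deriv_smul_eq_zero {F : Type*} [NormedAddCommGroup F]
    [NormedSpace ℝ F] [CompleteSpace F] {T : ℝ} (hT : 0 < T) {g : ℝ → F}
    (hg : LocallyIntegrableOn g (Ioo 0 T))
    (h : ∀ φ : ℝ → ℝ, ContDiff ℝ ∞ φ → HasCompactSupport φ → tsupport φ ⊆ Ioo 0 T →
      ∫ t, deriv φ t • g t = 0) :
    ∃ c : F, ∀ᵐ t, t ∈ Ioo 0 T → g t = c := by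
  obtain ⟨ρ₀, hρs, hρc, hρ, hρr, hρ1⟩ := exists_contDiff_tsupport_subset (n := ⊤)
    (Ioo_mem_nhds (half_pos hT) (half_lt_self hT))
  have hint : ∀ ψ : ℝ → ℝ, ContDiff ℝ ∞ ψ → HasCompactSupport ψ → tsupport ψ ⊆ Ioo 0 T →
      Integrable fun t => ψ t • g t := fun ψ hψ hψc hψs => by
    have h1 : IntegrableOn (fun t => ψ t • g t) (tsupport ψ) :=
      (hg.integrableOn_compact_subset hψs hψc).continuousOn_smul hψ.continuous.continuousOn hψc
    rw [integrableOn_iff_integrable_of_support_subset] at h1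
    · exact h1
    · exact (Function.support_smul_subset_left _ _).trans (subset_tsupport ψ)
  have hI : 0 < ∫ t, ρ₀ t := by
    refine (hρ.continuous.integral_pos_of_hasCompactSupport_nonneg_nonzero hρc
      (fun t => (hρr ⟨t, rfl⟩).1) (x := T / 2) (by rw [hρ1]; exact one_ne_zero))
  set c : F := (∫ t, ρ₀ t)⁻¹ • ∫ t, ρ₀ t • g t with hc
  refine ⟨c, ?_⟩
  have key := isOpen_Ioo.ae_eq_zero_of_integral_contDiff_smul_eq_zero (μ := volume)
    (f := fun t => g t - c) (hg.sub ((locallyIntegrable_const c).locallyIntegrableOn _))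
    fun ψ hψ hψc hψs => by
    -- Subtracting `κ * ρ₀` makes the mean zero, so the result `χ` is the derivative of a test
    -- function. The constant `c` is the `ρ₀`-average of `g`.
    set κ : ℝ := (∫ t, ψ t) * (∫ t, ρ₀ t)⁻¹ with hκ
    set χ : ℝ → ℝ := fun t => ψ t - κ * ρ₀ t with hχ
    have hχc : Continuous χ := hψ.continuous.sub (continuous_const.mul hρ.continuous)
    have hψi : Integrable ψ := hψ.continuous.integrable_of_hasCompactSupport hψc
    have hρi : Integrable ρ₀ := hρ.continuous.integrable_of_hasCompactSupport hρc
    have hχ0 : ∫ t, χ t = 0 := by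
      rw [hχ, integral_sub hψi (hρi.const_mul κ), integral_const_mul, hκ, mul_assoc,
        inv_mul_cancel₀ hI.ne', mul_one, sub_self]
    have hK : IsCompact (tsupport ψ ∪ tsupport ρ₀) := hψc.union hρc
    have hKne : (tsupport ψ ∪ tsupport ρ₀).Nonempty :=
      ⟨T / 2, Or.inr (subset_tsupport _ (by simp [hρ1]))⟩
    obtain ⟨l, hlK, hl⟩ := hK.exists_isLeast hKne
    obtain ⟨r, hrK, hr⟩ := hK.exists_isGreatest hKne
    have hl0 := (union_subset hψs hρs) hlK
    have hr0 := (union_subset hψs hρs) hrK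
    have hχz : ∀ t, t ∉ Icc l r → χ t = 0 := fun t ht => by
      have htK : t ∉ tsupport ψ ∪ tsupport ρ₀ := fun hm => ht ⟨hl hm, hr hm⟩
      rw [mem_union, not_or] at htK
      simp [hχ, image_eq_zero_of_notMem_tsupport htK.1, image_eq_zero_of_notMem_tsupport htK.2]
    set φ : ℝ → ℝ := fun t => ∫ s in (l - 1)..t, χ s with hφ
    have hφd : ∀ t, HasDerivAt φ (χ t) t := fun t => hχc.integral_hasStrictDerivAt _ _ |>.hasDerivAt
    have hderiv : deriv φ = χ := funext fun t => (hφd t).deriv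
    have hφs : ContDiff ℝ ∞ φ := by
      rw [contDiff_infty_iff_deriv, hderiv]
      exact ⟨fun t => (hφd t).differentiableAt, hψ.sub (contDiff_const.mul hρ)⟩
    have hφsupp : Function.support φ ⊆ Icc l r := by
      intro t ht
      by_contra hn
      apply ht
      rcases lt_or_ge t l with h1 | h1
      · refine (intervalIntegral.integral_congr (g := fun _ => 0) fun s hs => ?_).trans (by simp)
        refine hχz s fun hs' => ?_
        have h2 : max (l - 1) t < l := max_lt (by linarith) h1
        linarith [hs.2, hs'.1]
      · have h2 : r < t := by
          by_contra! h2; exact hn ⟨h1, h2⟩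
        rw [hφ, ← hχ0]
        simp only
        rw [intervalIntegral.integral_of_le (by linarith)]
        refine setIntegral_eq_integral_of_forall_compl_eq_zero fun s hs => ?_
        refine hχz s fun hs' => hs ⟨by linarith [hs'.1], by linarith [hs'.2]⟩
    have hφt : tsupport φ ⊆ Icc l r := closure_minimal hφsupp isClosed_Icc
    have h1 := h φ hφs (HasCompactSupport.of_support_subset_isCompact isCompact_Icc hφsupp)
      (hφt.trans fun t ht => ⟨hl0.1.trans_le ht.1, ht.2.trans_lt hr0.2⟩)
    rw [hderiv] at h1
    have h2 : ∫ t, χ t • g t = (∫ t, ψ t • g t) - κ • ∫ t, ρ₀ t • g t := by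
      have hκi : Integrable fun t => κ • ρ₀ t • g t := (hint ρ₀ hρ hρc hρs).smul κ
      rw [← integral_smul, ← integral_sub (hint ψ hψ hψc hψs) hκi]
      refine integral_congr_ae (.of_forall fun t => ?_)
      simp [hχ, sub_smul, mul_smul]
    have h3 : ∫ t, ψ t • (g t - c) = (∫ t, ψ t • g t) - (∫ t, ψ t) • c := by
      rw [← integral_smul_const, ← integral_sub (hint ψ hψ hψc hψs) (hψi.smul_const c)]
      simp_rw [smul_sub]
    rw [h3, hc, smul_smul, ← hκ, ← h2, h1]
  filter_upwards [key] with t ht ht'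
  exact sub_eq_zero.1 (ht ht')

theorem MemTimeH1.intervalIntegrable {n : ℕ} {T : ℝ} (hT : 0 ≤ T) {u u' : ℝ → L2 n}
    (hu : MemTimeH1 T u u') : IntervalIntegrable u' volume 0 T := by
  rw [intervalIntegrable_iff_integrableOn_Icc_of_le hT]
  exact hu.2.1.integrable one_le_two

/-- Integration by parts shows that `w - ∫ u'` has zero weak derivative; it is therefore constant,
and the constant is read off at `t = 0`. -/
theorem MemTimeH1.ae_eq_integral {n : ℕ} {T : ℝ} (hT : 0 < T) {u u' : ℝ → L2 n}
    (hu : MemTimeH1 T u u') (h0 : VanishesAtZero T u) :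
    ∀ᵐ t ∂(volume.restrict (Icc 0 T)), u t = ∫ s in (0 : ℝ)..t, u' s := by
  obtain ⟨w, hw, huw, hw0⟩ := h0
  have hi := hu.intervalIntegrable hT.le
  have hac := hi.absolutelyContinuousOnInterval_integral hT.le
  set U : ℝ → L2 n := fun t => ∫ s in (0 : ℝ)..t, u' s with hU
  have hUc : ContinuousOn U (Icc 0 T) := by
    have := hac.continuousOn
    rwa [uIcc_of_le hT.le] at this
  have hgc : ContinuousOn (fun t => w t - U t) (Icc 0 T) := hw.sub hUc
  obtain ⟨c, hc⟩ := ae_eq_const_of_integral_deriv_smul_eq_zero hT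
    ((hgc.mono Ioo_subset_Icc_self).locallyIntegrableOn measurableSet_Ioo)
    fun φ hφ hφc hφs => by
    have hdc : Continuous (deriv φ) := hφ.continuous_deriv (by simp)
    have hset : ∫ t, deriv φ t • (w t - U t) = ∫ t in Icc 0 T, deriv φ t • (w t - U t) := by
      refine (setIntegral_eq_integral_of_forall_compl_eq_zero fun t ht => ?_).symm
      have : t ∉ tsupport (deriv φ) := fun hm =>
        ht (Ioo_subset_Icc_self (hφs (tsupport_deriv_subset hm)))
      rw [image_eq_zero_of_notMem_tsupport this, zero_smul]
    have iw : IntegrableOn (fun t => deriv φ t • w t) (Icc 0 T) :=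
      (hdc.continuousOn.smul hw).integrableOn_Icc
    have iU : IntegrableOn (fun t => deriv φ t • U t) (Icc 0 T) :=
      (hdc.continuousOn.smul hUc).integrableOn_Icc
    have iu' : IntegrableOn (fun t => φ t • u' t) (Icc 0 T) :=
      ((intervalIntegrable_iff_integrableOn_Icc_of_le hT.le).1 hi).continuousOn_smul
        hφ.continuous.continuousOn isCompact_Icc
    have e1 : ∫ t in Icc 0 T, deriv φ t • w t = -∫ t in Icc 0 T, φ t • u' t := by
      rw [← hu.2.2 φ hφ hφc hφs]
      exact integral_congr_ae (huw.mono fun t ht => by simp only [ht])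
    have hφ0 : ∀ t, t ∉ Ioo 0 T → φ t = 0 := fun t ht =>
      image_eq_zero_of_notMem_tsupport fun hm => ht (hφs hm)
    have hφac : AbsolutelyContinuousOnInterval φ 0 T :=
      ContDiffOn.absolutelyContinuousOnInterval (hφ.of_le (by simp)).contDiffOn
    have e2 := (hφac.smul hac).integral_eq_sub_of_ae_hasDerivAt hT.le
      (f' := fun t => φ t • u' t + deriv φ t • U t)
      ((intervalIntegrable_iff_integrableOn_Icc_of_le hT.le).2 (iu'.add iU)) (by
        filter_upwards [hi.ae_hasDerivAt_integral] with t ht htI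
        have h1 := ht (by rwa [uIcc_of_le hT.le]) 0 left_mem_uIcc
        exact ((hφ.differentiable (by simp)) t).hasDerivAt.smul h1)
    simp only [Pi.smul_apply'] at e2
    rw [hφ0 0 (by simp), hφ0 T (by simp), zero_smul, zero_smul, sub_zero,
      intervalIntegral.integral_of_le hT.le, ← integral_Icc_eq_integral_Ioc,
      integral_add iu' iU] at e2
    rw [hset]
    simp_rw [smul_sub]
    rw [integral_sub iw iU, e1]
    rw [add_comm] at e2
    rw [eq_neg_of_add_eq_zero_left e2, sub_self]
  have hae : (fun t => w t - U t) =ᵐ[volume.restrict (Icc 0 T)] fun _ => c := by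
    rw [Filter.EventuallyEq, ae_restrict_iff' measurableSet_Icc]
    filter_upwards [hc, (Countable.ae_notMem (s := {0, T}) (by simp) volume)] with t h1 h2 h3
    simp only [mem_insert_iff, mem_singleton_iff, not_or] at h2
    exact h1 ⟨lt_of_le_of_ne h3.1 (Ne.symm h2.1), lt_of_le_of_ne h3.2 h2.2⟩
  have heq := Measure.eqOn_Icc_of_ae_eq volume hT.ne hae hgc continuousOn_const
  have hc0 : c = 0 := by
    have := heq (left_mem_Icc.2 hT.le)
    simpa [hw0, hU] using this.symm
  filter_upwards [huw, hae] with t h1 h2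
  rw [h1, ← sub_eq_zero, h2, hc0]

/-! ### The Carleman estimate -/

theorem absolutelyContinuousOnInterval_of_hasDerivAt_of_bound {F : Type*} [NormedAddCommGroup F]
    [NormedSpace ℝ F] {f f' : ℝ → F} {a b K : ℝ} (hab : a ≤ b)
    (hf : ∀ t ∈ Icc a b, HasDerivAt f (f' t) t) (hK : ∀ t ∈ Icc a b, ‖f' t‖ ≤ K) :
    AbsolutelyContinuousOnInterval f a b := by
  refine absolutelyContinuousOnInterval_of_norm_sub_le (g := fun _ => K) hab (by simp)
    fun s t has hst htb => ?_
  have := (convex_Icc a b).norm_image_sub_le_of_norm_hasDerivWithin_le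
    (fun x hx => (hf x hx).hasDerivWithinAt) hK ⟨has, hst.trans htb⟩ ⟨has.trans hst, htb⟩
  rw [intervalIntegral.integral_const, smul_eq_mul, mul_comm]
  rwa [Real.norm_of_nonneg (sub_nonneg.2 hst)] at this

/-- The primitive is bounded by some `K`, so increments of the quadratic form are at most `2 ‖A‖ K`
times those of the primitive. -/
theorem absolutelyContinuousOnInterval_quadratic {H : Type*} [NormedAddCommGroup H]
    [InnerProductSpace ℂ H] (A : H →L[ℂ] H) {f : ℝ → H} {τ : ℝ} (hτ : 0 ≤ τ)
    (hf : IntervalIntegrable f volume 0 τ) :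
    AbsolutelyContinuousOnInterval
      (fun t => (inner ℂ (A (∫ s in (0 : ℝ)..t, f s)) (∫ s in (0 : ℝ)..t, f s)).re) 0 τ := by
  have hac := hf.absolutelyContinuousOnInterval_integral hτ
  obtain ⟨K, hK⟩ := hac.exists_bound
  rw [uIcc_of_le hτ] at hK
  set w : ℝ → H := fun t => ∫ s in (0 : ℝ)..t, f s with hw
  have hK0 : 0 ≤ K := (norm_nonneg _).trans (hK 0 ⟨le_rfl, hτ⟩)
  refine absolutelyContinuousOnInterval_of_norm_sub_le (g := fun x => 2 * ‖A‖ * K * ‖f x‖) hτ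
    (hf.norm.const_mul _) fun s t has hst htb => ?_
  have hi : ∀ x, 0 ≤ x → x ≤ τ → IntervalIntegrable f volume 0 x := fun x hx hx' =>
    hf.mono_set (by rw [uIcc_of_le hx, uIcc_of_le hτ]; exact Icc_subset_Icc_right hx')
  have hws : ‖w t - w s‖ ≤ ∫ x in s..t, ‖f x‖ := by
    simp only [hw]
    rw [intervalIntegral.integral_interval_sub_left (hi t (has.trans hst) htb)
      (hi s has (hst.trans htb))]
    exact intervalIntegral.norm_integral_le_integral_norm hst
  have hs := hK s ⟨has, hst.trans htb⟩
  have ht := hK t ⟨has.trans hst, htb⟩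
  have hsplit : (inner ℂ (A (w t)) (w t)).re - (inner ℂ (A (w s)) (w s)).re =
      (inner ℂ (A (w t - w s)) (w t)).re + (inner ℂ (A (w s)) (w t - w s)).re := by
    rw [map_sub, inner_sub_left, inner_sub_right]
    simp
  change ‖(inner ℂ (A (w t)) (w t)).re - (inner ℂ (A (w s)) (w s)).re‖ ≤ _
  rw [hsplit, intervalIntegral.integral_const_mul]
  have hb : ∀ x y : H, ‖(inner ℂ (A x) y).re‖ ≤ ‖A‖ * ‖x‖ * ‖y‖ := fun x y =>
    (Complex.abs_re_le_norm _).trans ((norm_inner_le_norm _ _).trans (by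
      gcongr; exact A.le_opNorm x))
  calc _ ≤ ‖A‖ * ‖w t - w s‖ * ‖w t‖ + ‖A‖ * ‖w s‖ * ‖w t - w s‖ :=
        (norm_add_le _ _).trans (add_le_add (hb _ _) (hb _ _))
    _ ≤ ‖A‖ * ‖w t - w s‖ * K + ‖A‖ * K * ‖w t - w s‖ := by gcongr
    _ = 2 * ‖A‖ * K * ‖w t - w s‖ := by ring
    _ ≤ _ := by gcongr

/-! ### Multiplication operators and the energy inequality. -/

section Multiplication

variable {n : ℕ}

theorem exists_multiplicationOperator {c : EuclideanSpace ℝ (Fin n) → ℝ} (hc : Measurable c)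
    {K : ℝ} (hK : ∀ ξ, |c ξ| ≤ K) :
    ∃ A : L2 n →L[ℂ] L2 n, ∀ f : L2 n, A f =ᵐ[volume] fun ξ => (c ξ : ℂ) * f ξ := by
  have hc' : MemLp (fun ξ => (c ξ : ℂ)) ⊤ (volume : Measure (EuclideanSpace ℝ (Fin n))) :=
    memLp_top_of_bound (by fun_prop) K (.of_forall fun ξ => by simpa using hK ξ)
  have hs : ∀ f : L2 n, ((hc'.toLp _ : Lp ℂ ⊤ volume) • f : L2 n) =ᵐ[volume]
      fun ξ => (c ξ : ℂ) * f ξ := fun f => by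
    filter_upwards [Lp.coeFn_lpSMul (r := 2) (hc'.toLp _) f, hc'.coeFn_toLp] with ξ h1 h2
    rw [h1, Pi.smul_apply', h2, smul_eq_mul]
  refine ⟨LinearMap.mkContinuous
    { toFun := fun f => ((hc'.toLp _ : Lp ℂ ⊤ volume) • f : L2 n)
      map_add' := fun f g => ?_
      map_smul' := fun a f => ?_ } ‖(hc'.toLp _ : Lp ℂ ⊤ volume)‖ fun f => ?_, hs⟩
  · refine Lp.ext ?_
    filter_upwards [hs (f + g), hs f, hs g, Lp.coeFn_add f g,
      Lp.coeFn_add ((hc'.toLp _ : Lp ℂ ⊤ volume) • f : L2 n)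
        ((hc'.toLp _ : Lp ℂ ⊤ volume) • g : L2 n)] with ξ h1 h2 h3 h4 h5
    rw [h1, h5, Pi.add_apply, h2, h3, h4, Pi.add_apply, mul_add]
  · refine Lp.ext ?_
    filter_upwards [hs (a • f), hs f, Lp.coeFn_smul a f,
      Lp.coeFn_smul a ((hc'.toLp _ : Lp ℂ ⊤ volume) • f : L2 n)] with ξ h1 h2 h3 h4
    rw [h1, RingHom.id_apply, h4, Pi.smul_apply, h2, h3, Pi.smul_apply, smul_eq_mul, smul_eq_mul]
    ring
  · exact Lp.norm_smul_le _ _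

/-- Integrability comes from `f, g ∈ L²` alone, so the unbounded symbol `p` is allowed. -/
theorem re_inner_eq_integral {f g w : L2 n} {a b : EuclideanSpace ℝ (Fin n) → ℝ}
    (hf : f =ᵐ[volume] fun ξ => (a ξ : ℂ) * w ξ) (hg : g =ᵐ[volume] fun ξ => (b ξ : ℂ) * w ξ) :
    Integrable (fun ξ => a ξ * b ξ * ‖w ξ‖ ^ 2) ∧
      (inner ℂ f g).re = ∫ ξ, a ξ * b ξ * ‖w ξ‖ ^ 2 := by
  have hae : (fun ξ => (inner ℂ (f ξ) (g ξ)).re) =ᵐ[volume]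
      fun ξ => a ξ * b ξ * ‖w ξ‖ ^ 2 := by
    filter_upwards [hf, hg] with ξ h1 h2
    rw [h1, h2, ← smul_eq_mul, ← smul_eq_mul, inner_smul_left, inner_smul_right,
      inner_self_eq_norm_sq_to_K]
    simp only [Complex.conj_ofReal, Complex.coe_algebraMap]
    rw [mul_assoc]
    norm_cast
  have hi := L2.integrable_inner (𝕜 := ℂ) f g
  refine ⟨hi.re.congr hae, ?_⟩
  rw [← integral_congr_ae hae, L2.inner_def, ← Complex.reCLM_apply,
    ← ContinuousLinearMap.integral_comp_comm _ hi]
  rfl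

/-- The lower bound of the time derivative of the weighted energy. -/
theorem energy_derivative_lower_bound {w F P sw : L2 n} {X p s : EuclideanSpace ℝ (Fin n) → ℝ}
    {φ δ e C : ℝ} (hX : ∀ ξ, 1 ≤ X ξ) (hXw : Integrable fun ξ => X ξ * ‖w ξ‖ ^ 2)
    (hP : P =ᵐ[volume] fun ξ => (p ξ : ℂ) * w ξ) (hs : sw =ᵐ[volume] fun ξ => (s ξ : ℂ) * w ξ)
    (he : 0 < e) (hF : ‖F - P‖ ^ 2 ≤ C * ∫ ξ, X ξ * ‖w ξ‖ ^ 2)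
    (hpw : ∀ ξ, (C / e + 1) * X ξ ≤ δ + 2 * s ξ * (p ξ - φ) - e * s ξ ^ 2) :
    ‖w‖ ^ 2 ≤ δ * ‖w‖ ^ 2 - 2 * φ * (inner ℂ sw w).re + 2 * (inner ℂ sw F).re := by
  have hw1 : w =ᵐ[volume] fun ξ => ((1 : ℝ) : ℂ) * w ξ := .of_forall fun ξ => by simp
  obtain ⟨i1, e1⟩ := re_inner_eq_integral (a := s) (b := fun _ => 1) hs hw1
  obtain ⟨i2, e2⟩ := re_inner_eq_integral hs hP
  obtain ⟨i3, e3⟩ := re_inner_eq_integral hs hs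
  have hsn : (inner ℂ sw sw).re = ‖sw‖ ^ 2 := inner_self_eq_norm_sq (𝕜 := ℂ) sw
  have i0 := L2_integrable_norm_sq w
  have hFsplit : (inner ℂ sw F).re = (inner ℂ sw P).re + (inner ℂ sw (F - P)).re := by
    rw [inner_sub_right]; simp
  -- Young's inequality with weight `e`: the first term is offset by `-e s²` in the pointwise
  -- inequality, the second by `C / e`; the remaining `1` in `C / e + 1` yields `‖w‖ ^ 2`.
  have hcs : -(e * ‖sw‖ ^ 2) - e⁻¹ * ‖F - P‖ ^ 2 ≤ 2 * (inner ℂ sw (F - P)).re := by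
    have h1 : |(inner ℂ sw (F - P)).re| ≤ ‖sw‖ * ‖F - P‖ :=
      (Complex.abs_re_le_norm _).trans (norm_inner_le_norm _ _)
    have h2 : 0 ≤ e⁻¹ * (e * ‖sw‖ - ‖F - P‖) ^ 2 := by positivity
    have h3 : e⁻¹ * (e * ‖sw‖ - ‖F - P‖) ^ 2 =
        e * ‖sw‖ ^ 2 - 2 * (‖sw‖ * ‖F - P‖) + e⁻¹ * ‖F - P‖ ^ 2 := by
      field_simp; ring
    linarith [neg_abs_le (inner ℂ sw (F - P)).re]
  have hFe : e⁻¹ * ‖F - P‖ ^ 2 ≤ C / e * ∫ ξ, X ξ * ‖w ξ‖ ^ 2 := by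
    calc e⁻¹ * ‖F - P‖ ^ 2 ≤ e⁻¹ * (C * ∫ ξ, X ξ * ‖w ξ‖ ^ 2) := by gcongr
      _ = _ := by ring
  have hmain : (C / e + 1) * ∫ ξ, X ξ * ‖w ξ‖ ^ 2 ≤
      δ * ‖w‖ ^ 2 - 2 * φ * (inner ℂ sw w).re + 2 * (inner ℂ sw P).re - e * ‖sw‖ ^ 2 := by
    have j1 : Integrable fun ξ => δ * ‖w ξ‖ ^ 2 - 2 * φ * (s ξ * 1 * ‖w ξ‖ ^ 2) :=
      (i0.const_mul _).sub (i1.const_mul _)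
    have j2 : Integrable fun ξ => δ * ‖w ξ‖ ^ 2 - 2 * φ * (s ξ * 1 * ‖w ξ‖ ^ 2) +
        2 * (s ξ * p ξ * ‖w ξ‖ ^ 2) := j1.add (i2.const_mul _)
    rw [← hsn, e1, e2, e3, L2_norm_sq_eq_integral, ← integral_const_mul, ← integral_const_mul,
      ← integral_const_mul, ← integral_const_mul, ← integral_const_mul,
      ← integral_sub (i0.const_mul _) (i1.const_mul _), ← integral_add j1 (i2.const_mul _),
      ← integral_sub j2 (i3.const_mul _)]
    refine integral_mono (hXw.const_mul _) (j2.sub (i3.const_mul _)) fun ξ => ?_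
    have := mul_le_mul_of_nonneg_right (hpw ξ) (sq_nonneg ‖w ξ‖)
    linarith
  have hXge : ‖w‖ ^ 2 ≤ ∫ ξ, X ξ * ‖w ξ‖ ^ 2 := by
    rw [L2_norm_sq_eq_integral]
    exact integral_mono i0 hXw fun ξ => le_mul_of_one_le_left (sq_nonneg _) (hX ξ)
  linarith

end Multiplication

/-- Integrate the derivative of `E ⟨(c - φ) w, w⟩`. Since `c` is bounded and independent of time,
this energy is absolutely continuous for every `L²`-valued primitive `w`, without spatial regularity
at every time. -/
theorem carleman_estimate {n : ℕ} {σ φ : ℝ → ℝ} {M N τ e C b K : ℝ} (hσ : OsgoodModulus σ)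
    (hφ : IsOsgoodWeight σ M N τ φ) (hM : 0 < M) (hN : 0 < N) (hτ : 0 ≤ τ) (he : 0 < e)
    {f P : ℝ → L2 n} {p : ℝ → EuclideanSpace ℝ (Fin n) → ℝ} {c X : EuclideanSpace ℝ (Fin n) → ℝ}
    (hf : IntervalIntegrable f volume 0 τ) (hc : Measurable c) (hcK : ∀ ξ, |c ξ| ≤ K)
    (hX : ∀ ξ, 1 ≤ X ξ)
    (hgood : ∀ᵐ t, t ∈ Icc 0 τ →
      (Integrable fun ξ => X ξ * ‖(∫ s in (0 : ℝ)..t, f s) ξ‖ ^ 2) ∧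
      (P t =ᵐ[volume] fun ξ => (p t ξ : ℂ) * (∫ s in (0 : ℝ)..t, f s) ξ) ∧
      ‖f t - P t‖ ^ 2 ≤ C * ∫ ξ, X ξ * ‖(∫ s in (0 : ℝ)..t, f s) ξ‖ ^ 2)
    (hpw : ∀ t ∈ Icc 0 τ, ∀ ξ, (C / e + 1) * X ξ ≤ M * φ t ^ 2 * σ (φ t)⁻¹ +
      2 * (c ξ - φ t) * (p t ξ - φ t) - e * (c ξ - φ t) ^ 2)
    (hend : Integrable fun ξ => X ξ * ‖(∫ s in (0 : ℝ)..τ, f s) ξ‖ ^ 2)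
    (hcτ : ∀ ξ, c ξ - φ τ ≤ b * X ξ) {τ' : ℝ} (hτ' : τ' ∈ Icc 0 τ) :
    Real.exp (2 * (N * (τ - τ'))) * ∫ t in (0 : ℝ)..τ', ‖∫ s in (0 : ℝ)..t, f s‖ ^ 2 ≤
      b * ∫ ξ, X ξ * ‖(∫ s in (0 : ℝ)..τ, f s) ξ‖ ^ 2 := by
  obtain ⟨A, hA⟩ := exists_multiplicationOperator hc hcK
  set w : ℝ → L2 n := fun t => ∫ s in (0 : ℝ)..t, f s with hw
  have hwc : ContinuousOn w (Icc 0 τ) := by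
    have := (hf.absolutelyContinuousOnInterval_integral hτ).continuousOn
    rwa [uIcc_of_le hτ] at this
  -- the exponential weight
  set φe : ℝ → ℝ := IccExtend hτ ((Icc 0 τ).domRestrict φ) with hφe
  have hφec : Continuous φe :=
    (continuousOn_iff_continuous_domRestrict.1 hφ.continuousOn).Icc_extend'
  have hφeq : ∀ t ∈ Icc 0 τ, φe t = φ t := fun t ht => by
    simp [hφe, IccExtend_of_mem _ _ ht, domRestrict]
  set ψ : ℝ → ℝ := fun t => ∫ s in t..τ, φe s with hψ
  have hψd : ∀ t, HasDerivAt ψ (-φe t) t := fun t => by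
    have h1 := hφec.integral_hasStrictDerivAt τ t |>.hasDerivAt.neg
    refine h1.congr_of_eventuallyEq (.of_forall fun x => ?_)
    exact intervalIntegral.integral_symm τ x
  have hψτ : ψ τ = 0 := intervalIntegral.integral_same
  have hψge : ∀ t ∈ Icc 0 τ, N * (τ - t) ≤ ψ t := fun t ht => by
    have : ∫ _s in t..τ, N ≤ ∫ s in t..τ, φe s :=
      intervalIntegral.integral_mono_on ht.2 (by simp) (hφec.intervalIntegrable _ _)
        fun s hs => by
          have hs' : s ∈ Icc 0 τ := ⟨ht.1.trans hs.1, hs.2⟩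
          rw [hφeq s hs']; exact hφ.le hs'
    rw [intervalIntegral.integral_const, smul_eq_mul, mul_comm] at this
    exact this
  set E : ℝ → ℝ := fun t => Real.exp (2 * ψ t) with hE
  have hEd : ∀ t, HasDerivAt E (E t * (2 * -φe t)) t := fun t => ((hψd t).const_mul 2).exp
  have hEc : Continuous E := continuous_iff_continuousAt.2 fun t => (hEd t).continuousAt
  have hEac : AbsolutelyContinuousOnInterval E 0 τ := by
    obtain ⟨K', hK'⟩ := (isCompact_Icc (a := (0 : ℝ)) (b := τ)).exists_bound_of_continuousOn
      (f := fun t => E t * (2 * -φe t)) (by fun_prop)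
    exact absolutelyContinuousOnInterval_of_hasDerivAt_of_bound hτ (fun t _ => hEd t) hK'
  have hφac : AbsolutelyContinuousOnInterval φ 0 τ := by
    refine absolutelyContinuousOnInterval_of_hasDerivAt_of_bound hτ (K := M * φ 0 ^ 2 * σ N⁻¹)
      (fun t ht => hφ.hasDerivAt ht) fun t ht => ?_
    have h0 := hN.trans_le (hφ.le ht)
    have h1 := hσ.pos (inv_pos.2 h0)
    rw [norm_neg, Real.norm_of_nonneg (by positivity)]
    have h2 : φ t ≤ φ 0 := hφ.antitoneOn hσ hM hN ⟨le_rfl, hτ⟩ ht ht.1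
    have h3 : σ (φ t)⁻¹ ≤ σ N⁻¹ := hσ.mono (inv_pos.2 h0).le (by gcongr; exact hφ.le ht)
    gcongr
  -- the energy
  have hαac := absolutelyContinuousOnInterval_quadratic A hτ hf
  have hβac := absolutelyContinuousOnInterval_quadratic (.id ℂ (L2 n)) hτ hf
  set α : ℝ → ℝ := fun t => (inner ℂ (A (w t)) (w t)).re with hα
  set β : ℝ → ℝ := fun t => (inner ℂ (w t) (w t)).re with hβ
  have hJac : AbsolutelyContinuousOnInterval (E * (α - φ * β)) 0 τ :=
    hEac.mul (hαac.sub (hφac.mul hβac))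
  have hβn : ∀ t, β t = ‖w t‖ ^ 2 := fun t => inner_self_eq_norm_sq (𝕜 := ℂ) (w t)
  have hsw : ∀ t, (A (w t) - (φ t : ℂ) • w t : L2 n) =ᵐ[volume]
      fun ξ => ((c ξ - φ t : ℝ) : ℂ) * w t ξ := fun t => by
    filter_upwards [hA (w t), Lp.coeFn_smul (φ t : ℂ) (w t),
      Lp.coeFn_sub (A (w t)) ((φ t : ℂ) • w t)] with ξ h1 h2 h3
    rw [h3, Pi.sub_apply, h1, h2, Pi.smul_apply, smul_eq_mul]
    push_cast; ring
  have hsin : ∀ t (g : L2 n), (inner ℂ (A (w t) - (φ t : ℂ) • w t) g).re =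
      (inner ℂ (A (w t)) g).re - φ t * (inner ℂ (w t) g).re := fun t g => by
    rw [inner_sub_left, inner_smul_left, Complex.conj_ofReal, Complex.sub_re, Complex.re_ofReal_mul]
  -- The operator is symmetric because `c` is real.
  have hsymm : ∀ g h : L2 n, (inner ℂ (A g) h).re = (inner ℂ (A h) g).re := fun g h => by
    rw [← inner_conj_symm (A h) g, Complex.conj_re, L2.inner_def, L2.inner_def]
    congr 1
    refine integral_congr_ae ?_
    filter_upwards [hA g, hA h] with ξ h1 h2
    rw [h1, h2, ← smul_eq_mul, ← smul_eq_mul, inner_smul_left, inner_smul_right,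
      Complex.conj_ofReal]
  have hderiv : ∀ᵐ t, t ∈ Icc 0 τ → E t * ‖w t‖ ^ 2 ≤ deriv (E * (α - φ * β)) t := by
    filter_upwards [hgood, hf.ae_hasDerivAt_integral] with t h1 h2 ht
    obtain ⟨hi, hP, hF⟩ := h1 ht
    have hwd : HasDerivAt w (f t) t := h2 (by rwa [uIcc_of_le hτ]) 0 left_mem_uIcc
    have hAd : HasDerivAt (fun t => A (w t)) (A (f t)) t :=
      (A.restrictScalars ℝ).hasFDerivAt.comp_hasDerivAt t hwd
    have hαd : HasDerivAt α (2 * (inner ℂ (A (w t)) (f t)).re) t := by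
      have := Complex.reCLM.hasFDerivAt.comp_hasDerivAt t (hAd.inner ℂ hwd)
      refine this.congr_deriv ?_
      simp only [Complex.reCLM_apply, Complex.add_re]
      rw [hsymm (f t) (w t)]; ring
    have hβd : HasDerivAt β (2 * (inner ℂ (w t) (f t)).re) t := by
      have := Complex.reCLM.hasFDerivAt.comp_hasDerivAt t (hwd.inner ℂ hwd)
      refine this.congr_deriv ?_
      simp only [Complex.reCLM_apply, Complex.add_re]
      rw [← inner_conj_symm (f t) (w t), Complex.conj_re]; ring
    have hJ := (hEd t).mul (hαd.sub ((hφ.hasDerivAt ht).mul hβd))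
    rw [hJ.deriv]
    have key := energy_derivative_lower_bound hX hi hP (hsw t) he hF (hpw t ht)
    rw [hsin, hsin] at key
    have hβ' : (inner ℂ (w t) (w t)).re = ‖w t‖ ^ 2 := hβn t
    have := mul_le_mul_of_nonneg_left key (Real.exp_pos (2 * ψ t)).le
    simp only [Pi.sub_apply, Pi.mul_apply]
    rw [hφeq t ht]
    change E t * _ ≤ E t * _ at this
    refine this.trans (le_of_eq ?_)
    simp only [hα, hβ]
    rw [hβ']
    ring
  have hint : ∫ t in (0 : ℝ)..τ, E t * ‖w t‖ ^ 2 ≤ (E * (α - φ * β)) τ - (E * (α - φ * β)) 0 := by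
    rw [← hJac.integral_deriv_eq_sub]
    refine intervalIntegral.integral_mono_ae_restrict hτ ?_ hJac.intervalIntegrable_deriv ?_
    · refine ContinuousOn.intervalIntegrable ?_
      rw [uIcc_of_le hτ]
      exact hEc.continuousOn.mul (hwc.norm.pow 2)
    · exact (ae_restrict_iff' measurableSet_Icc).2 hderiv
  have hJ0 : (E * (α - φ * β)) 0 = 0 := by
    simp [hα, hβ, hw]
  have hJτ : (E * (α - φ * β)) τ ≤ b * ∫ ξ, X ξ * ‖w τ ξ‖ ^ 2 := by
    have hw1 : w τ =ᵐ[volume] fun ξ => ((1 : ℝ) : ℂ) * w τ ξ := .of_forall fun ξ => by simp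
    obtain ⟨i1, e1⟩ := re_inner_eq_integral (a := fun ξ => c ξ - φ τ) (b := fun _ => 1)
      (hsw τ) hw1
    rw [hsin] at e1
    have : (E * (α - φ * β)) τ = (inner ℂ (A (w τ)) (w τ)).re - φ τ * (inner ℂ (w τ) (w τ)).re := by
      simp [hE, hψτ, hα, hβ]
    rw [this, e1, ← integral_const_mul]
    refine integral_mono i1 (hend.const_mul b) fun ξ => ?_
    have := mul_le_mul_of_nonneg_right (hcτ ξ) (sq_nonneg ‖w τ ξ‖)
    simp only [mul_one]
    linarith
  have hleft : Real.exp (2 * (N * (τ - τ'))) * ∫ t in (0 : ℝ)..τ', ‖w t‖ ^ 2 ≤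
      ∫ t in (0 : ℝ)..τ, E t * ‖w t‖ ^ 2 := by
    have hc1 : ContinuousOn (fun t => ‖w t‖ ^ 2) (Icc 0 τ) := hwc.norm.pow 2
    have hc2 : ContinuousOn (fun t => E t * ‖w t‖ ^ 2) (Icc 0 τ) := hEc.continuousOn.mul hc1
    have hsub : Icc 0 τ' ⊆ Icc 0 τ := Icc_subset_Icc_right hτ'.2
    have j1 : IntervalIntegrable (fun t => E t * ‖w t‖ ^ 2) volume 0 τ' :=
      ContinuousOn.intervalIntegrable (by rw [uIcc_of_le hτ'.1]; exact hc2.mono hsub)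
    have j2 : IntervalIntegrable (fun t => E t * ‖w t‖ ^ 2) volume τ' τ :=
      ContinuousOn.intervalIntegrable (by
        rw [uIcc_of_le hτ'.2]; exact hc2.mono (Icc_subset_Icc_left hτ'.1))
    rw [← intervalIntegral.integral_const_mul, ← intervalIntegral.integral_add_adjacent_intervals
      j1 j2]
    have h1 : ∫ t in (0 : ℝ)..τ', Real.exp (2 * (N * (τ - τ'))) * ‖w t‖ ^ 2 ≤
        ∫ t in (0 : ℝ)..τ', E t * ‖w t‖ ^ 2 := by
      refine intervalIntegral.integral_mono_on hτ'.1 ?_ j1 fun t ht => ?_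
      · refine ContinuousOn.intervalIntegrable ?_
        rw [uIcc_of_le hτ'.1]; exact continuousOn_const.mul (hc1.mono hsub)
      · have : N * (τ - τ') ≤ ψ t := le_trans (by gcongr; exact ht.2) (hψge t (hsub ht))
        simp only [hE]
        gcongr
    have h2 : 0 ≤ ∫ t in τ'..τ, E t * ‖w t‖ ^ 2 :=
      intervalIntegral.integral_nonneg hτ'.2 fun t _ =>
        mul_nonneg (Real.exp_pos _).le (sq_nonneg _)
    linarith
  linarith

/-! ### Backward uniqueness -/

section Symbol

variable {n m : ℕ} {T : ℝ} {R : ℝ → EuclideanSpace ℝ (multiIndices n (2 * m))}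

theorem exists_operatorSymbol_bounds (hR : ContinuousOn R (Icc 0 T))
    (hell : ∃ Λ : ℝ, 0 < Λ ∧ EllipticBounded T Λ R) :
    ∃ a b : ℝ, 0 < a ∧ a ≤ 1 ∧ 1 ≤ b ∧ ∀ t ∈ Icc 0 T, ∀ ξ : EuclideanSpace ℝ (Fin n),
      a * sobolevWeight m ξ - b ≤ operatorSymbol (R t) ξ ∧
      operatorSymbol (R t) ξ ≤ b * sobolevWeight m ξ := by
  obtain ⟨Λ, hΛ, hell⟩ := hell
  obtain ⟨B, hB⟩ := isCompact_Icc.exists_bound_of_continuousOn hR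
  obtain ⟨a, b₀, ha, ha1, hlow⟩ := operatorSymbol_lower_bound (n := n) (m := m) hΛ
  set D : ℝ := (multiIndices n (2 * m)).card * |B| with hD
  have hD0 : 0 ≤ D := by positivity
  have habs : ∀ t ∈ Icc 0 T, ∀ ξ : EuclideanSpace ℝ (Fin n),
      |operatorSymbol (R t) ξ| ≤ D * sobolevWeight m ξ := fun t ht ξ => by
    refine (abs_operatorSymbol_le (R t) ξ).trans ?_
    have := zero_le_one.trans (one_le_sobolevWeight m ξ)
    rw [hD]
    gcongr
    exact (hB t ht).trans (le_abs_self B)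
  refine ⟨a, 2 + |b₀| + 2 * D, ha, ha1, by linarith [abs_nonneg b₀], fun t ht ξ => ⟨?_, ?_⟩⟩
  · by_cases hξ : ξ = 0
    · have hX : sobolevWeight m ξ ≤ 2 := by
        rw [sobolevWeight, hξ, norm_zero, mul_zero]
        linarith [pow_le_one₀ (n := 2 * m) (le_refl (0 : ℝ)) zero_le_one]
      have h1 := habs t ht ξ
      have h2 : D * sobolevWeight m ξ ≤ D * 2 := by gcongr
      have h3 : a * sobolevWeight m ξ ≤ 1 * 2 := by
        have := zero_le_one.trans (one_le_sobolevWeight m ξ)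
        gcongr
      linarith [neg_abs_le (operatorSymbol (R t) ξ), abs_nonneg b₀]
    · have := hlow (R t) ξ hξ fun η hη => ⟨(hell t ht η hη).1, (hell t ht η hη).2.1⟩
      linarith [le_abs_self b₀]
  · refine (le_abs_self _).trans ((habs t ht ξ).trans ?_)
    have := zero_le_one.trans (one_le_sobolevWeight m ξ)
    gcongr
    linarith [abs_nonneg b₀]

theorem abs_operatorSymbol_sub_le (hR : ContinuousOn R (Icc 0 T)) {t s : ℝ} (ht : t ∈ Icc 0 T)
    (hs : s ∈ Icc 0 T) (ξ : EuclideanSpace ℝ (Fin n)) :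
    |operatorSymbol (R t) ξ - operatorSymbol (R s) ξ| ≤
      (multiIndices n (2 * m)).card * sobolevWeight m ξ *
        (modulusOfContinuity (Icc 0 T) R |t - s| + |t - s|) := by
  rw [← operatorSymbol_sub]
  have hX := zero_le_one.trans (one_le_sobolevWeight m ξ)
  calc |operatorSymbol (R t - R s) ξ|
      ≤ (multiIndices n (2 * m)).card * ‖R t - R s‖ * sobolevWeight m ξ :=
        abs_operatorSymbol_le _ ξ
    _ = (multiIndices n (2 * m)).card * sobolevWeight m ξ * ‖R t - R s‖ := by ring
    _ ≤ _ := by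
        gcongr
        exact (norm_sub_le_modulusOfContinuity hR ht hs le_rfl).trans
          (le_add_of_nonneg_right (abs_nonneg _))

end Symbol

/-- Elements of `H^{2m}` are square integrable against the weight of `H^m`. -/
theorem MemH.integrable_sobolevWeight_mul {n m : ℕ} {f : L2 n} (h : MemH (2 * m) f)
    {r : EuclideanSpace ℝ (multiIndices n (2 * m))} {a b : ℝ} (ha : 0 < a)
    (hr : ∀ ξ : EuclideanSpace ℝ (Fin n), a * sobolevWeight m ξ - b ≤ operatorSymbol r ξ) :
    Integrable fun ξ => sobolevWeight m ξ * ‖(𝓕 f : L2 n) ξ‖ ^ 2 := by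
  have hw1 : (𝓕 f : L2 n) =ᵐ[volume] fun ξ => ((1 : ℝ) : ℂ) * (𝓕 f : L2 n) ξ :=
    .of_forall fun ξ => by simp
  -- `p |𝓕 f|²` is integrable as a product of two `L²` functions, and `a X ≤ p + b`.
  obtain ⟨i1, -⟩ := re_inner_eq_integral (h.fourier_spatialOp r) hw1
  have i2 := (i1.add ((L2_integrable_norm_sq (𝓕 f : L2 n)).const_mul b)).const_mul a⁻¹
  refine i2.mono' ?_ (.of_forall fun ξ => ?_)
  · exact (continuous_sobolevWeight m).aestronglyMeasurable.mul
      (L2_integrable_norm_sq (𝓕 f : L2 n)).1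
  · have hX := zero_le_one.trans (one_le_sobolevWeight m ξ)
    rw [Real.norm_of_nonneg (by positivity)]
    have := mul_le_mul_of_nonneg_right (hr ξ) (sq_nonneg ‖(𝓕 f : L2 n) ξ‖)
    simp only [Pi.add_apply, mul_one]
    rw [inv_mul_eq_div, le_div_iff₀ ha]
    linarith

theorem MemH.mono {n k l : ℕ} (hkl : k ≤ l) {f : L2 n} (h : MemH l f) : MemH k f := fun α hα =>
  h α (mem_multiIndices.2 ((mem_multiIndices.1 hα).trans hkl))

theorem nonpos_of_exp_mul_le {I D d N₀ : ℝ} (hd : 0 < d)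
    (h : ∀ N, N₀ ≤ N → Real.exp (2 * (N * d)) * I ≤ D) : I ≤ 0 := by
  by_contra! hI
  have hlim : Filter.Tendsto (fun N : ℝ => Real.exp (2 * (N * d)) * I) Filter.atTop
      Filter.atTop := by
    refine Filter.Tendsto.atTop_mul_const hI (Real.tendsto_exp_atTop.comp ?_)
    exact Filter.Tendsto.const_mul_atTop two_pos (Filter.tendsto_id.atTop_mul_const hd)
  obtain ⟨N, hN1, hN2⟩ := ((hlim.eventually_gt_atTop D).and (Filter.eventually_ge_atTop N₀)).exists
  exact absurd (h N hN2) hN1.not_ge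

theorem theorem1 (n m : ℕ) (T : ℝ) (hT : 0 < T)
    (R : ℝ → EuclideanSpace ℝ (multiIndices n (2 * m))) (hR : ContinuousOn R (Icc 0 T))
    (hell : ∃ Λ : ℝ, 0 < Λ ∧ EllipticBounded T Λ R)
    (hosg : OsgoodCondition (modulusOfContinuity (Icc 0 T) R))
    (u u' : ℝ → L2 n) (hu : MemTimeH1 T u u') (huH : MemTimeL2H T (2 * m) u)
    (C : ℝ)
    (hineq : ∀ᵐ t ∂(volume.restrict (Icc 0 T)),
      ‖u' t - spatialOp (R t) (u t)‖ ≤ C * normH m (u t))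
    (h0 : VanishesAtZero T u) :
    ∀ᵐ t ∂(volume.restrict (Icc 0 T)), u t = 0 := by
  obtain ⟨a, b, ha, ha1, hb, hsymb⟩ := exists_operatorSymbol_bounds hR hell
  have hσ := osgoodModulus_of_osgoodCondition hT.le hR hosg
  set σ : ℝ → ℝ := fun s => modulusOfContinuity (Icc 0 T) R s + s with hσdef
  set L : ℝ := ((multiIndices n (2 * m)).card : ℝ) with hL
  set C₂ : ℝ := C ^ 2 * ((multiIndices n m).card : ℝ) with hC₂
  set e : ℝ := a / (12 * b) with he
  have he0 : 0 < e := by positivity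
  have hκ : 0 < C₂ / e + 1 := by positivity
  have hσ1 := hσ.pos one_pos
  -- Makes the condition on `M` in `multiplier_pointwise` an equality; `M` does not depend on `N`.
  set M : ℝ := (4 * L + 4 * L ^ 2 * σ 1 + (C₂ / e + 1)) / ((a / 12) ^ 2 / 2) with hMdef
  have hM : 0 < M := by positivity
  -- the Fourier transform in space
  have hui := hu.intervalIntegrable hT.le
  set F : L2 n →L[ℂ] L2 n := (Lp.fourierTransformₗᵢ (EuclideanSpace ℝ (Fin n))
    ℂ).toContinuousLinearEquiv.toContinuousLinearMap with hF
  set f : ℝ → L2 n := fun t => F (u' t) with hf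
  have hfi : IntervalIntegrable f volume 0 T := by
    rw [intervalIntegrable_iff] at hui ⊢
    exact F.integrable_comp hui
  set w : ℝ → L2 n := fun t => ∫ s in (0 : ℝ)..t, f s with hw
  have hFw : ∀ t ∈ Icc 0 T, F (∫ s in (0 : ℝ)..t, u' s) = w t := fun t ht => by
    refine (F.intervalIntegral_comp_comm (hui.mono_set ?_)).symm
    rw [uIcc_of_le ht.1, uIcc_of_le hT.le]
    exact Icc_subset_Icc_right ht.2
  have huw := hu.ae_eq_integral hT h0
  have hgood : ∀ᵐ t, t ∈ Icc 0 T →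
      (Integrable fun ξ => sobolevWeight m ξ * ‖w t ξ‖ ^ 2) ∧
      (F (spatialOp (R t) (u t)) =ᵐ[volume]
        fun ξ => (operatorSymbol (R t) ξ : ℂ) * w t ξ) ∧
      ‖f t - F (spatialOp (R t) (u t))‖ ^ 2 ≤ C₂ * ∫ ξ, sobolevWeight m ξ * ‖w t ξ‖ ^ 2 := by
    rw [ae_restrict_iff' measurableSet_Icc] at huw hineq
    have hH := (ae_restrict_iff' measurableSet_Icc).1 huH.1
    filter_upwards [huw, hineq, hH] with t h1 h2 h3 ht
    have hwt : w t = 𝓕 (u t) := by rw [← hFw t ht, ← h1 ht]; rfl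
    have hint := (h3 ht).integrable_sobolevWeight_mul ha fun ξ => (hsymb t ht ξ).1
    rw [hwt]
    refine ⟨hint, (h3 ht).fourier_spatialOp (R t), ?_⟩
    have hn : ‖f t - F (spatialOp (R t) (u t))‖ = ‖u' t - spatialOp (R t) (u t)‖ := by
      rw [hf, ← map_sub]
      exact Lp.norm_fourier_eq _
    rw [hn, hC₂, mul_assoc]
    calc ‖u' t - spatialOp (R t) (u t)‖ ^ 2 ≤ (C * normH m (u t)) ^ 2 := by
          gcongr; exact h2 ht
      _ = C ^ 2 * normH m (u t) ^ 2 := mul_pow _ _ _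
      _ ≤ _ := by
          gcongr
          exact normH_sq_le ((h3 ht).mono (by omega)) hint
  have hwc : ContinuousOn w (Icc 0 T) := by
    have := (hfi.absolutelyContinuousOnInterval_integral hT.le).continuousOn
    rwa [uIcc_of_le hT.le] at this
  have hPc : ∀ τ ≤ T, ContinuousOn (fun z : ℝ × EuclideanSpace ℝ (Fin n) =>
      operatorSymbol (R z.1) z.2) (Icc 0 τ ×ˢ univ) := fun τ hτ => by
    refine continuous_operatorSymbol.comp_continuousOn (ContinuousOn.prodMk ?_ (by fun_prop))
    exact hR.comp continuousOn_fst fun z hz => ⟨hz.1.1, hz.1.2.trans hτ⟩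
  have hzero : ∀ τ' τ, 0 ≤ τ' → τ' < τ → τ ≤ T →
      (Integrable fun ξ => sobolevWeight m ξ * ‖w τ ξ‖ ^ 2) →
      ∫ t in (0 : ℝ)..τ', ‖w t‖ ^ 2 ≤ 0 := by
    intro τ' τ hτ'0 hlt hτT hend
    have hτ : 0 ≤ τ := hτ'0.trans hlt.le
    have hsub : Icc 0 τ ⊆ Icc 0 T := Icc_subset_Icc_right hτT
    -- The weight and the level both change with `N`, but the right-hand side does not.
    refine nonpos_of_exp_mul_le (D := b * ∫ ξ, sobolevWeight m ξ * ‖w τ ξ‖ ^ 2) (sub_pos.2 hlt)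
      (N₀ := max (2 * b / a) (16 * (C₂ / e + 1) / a ^ 2)) fun N hN => ?_
    have hN1 : 2 * b ≤ a * N := by
      have := (le_max_left _ _).trans hN
      rwa [div_le_iff₀' ha] at this
    have hN2 : 16 * (C₂ / e + 1) ≤ a ^ 2 * N := by
      have := (le_max_right _ _).trans hN
      rwa [div_le_iff₀' (by positivity)] at this
    have hN0 : 0 < N := by
      by_contra! hneg
      linarith [mul_nonpos_of_nonneg_of_nonpos ha.le hneg]
    obtain ⟨φ, hφ⟩ := hσ.exists_weight (τ := τ) hM hN0
    have hpc : ∀ ξ, ContinuousOn (fun t => operatorSymbol (R t) ξ) (Icc 0 τ) := fun ξ =>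
      (hPc τ hτT).comp (f := fun t : ℝ => (t, ξ)) (by fun_prop) fun t ht => ⟨ht, trivial⟩
    have hbd := fun ξ => crossingLevel_bounds (a := a) (X := sobolevWeight m ξ) hσ hφ hM hN0 hτ
      (hpc ξ)
    exact carleman_estimate (P := fun t => F (spatialOp (R t) (u t)))
      (p := fun t ξ => operatorSymbol (R t) ξ) (X := sobolevWeight m) (C := C₂)
      (c := fun ξ => crossingLevel φ τ a (sobolevWeight m ξ) fun t => operatorSymbol (R t) ξ)
      hσ hφ hM hN0 hτ he0
      (hfi.mono_set (by rwa [uIcc_of_le hτ, uIcc_of_le hT.le]))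
      (measurable_crossingLevel hτ hφ.continuousOn (continuous_sobolevWeight m).measurable
        (hPc τ hτT))
      (fun ξ => by rw [abs_of_nonneg (hbd ξ).1]; exact (hbd ξ).2)
      (one_le_sobolevWeight m)
      (hgood.mono fun t h ht => h (hsub ht))
      (fun t ht ξ => multiplier_pointwise (L := L) hσ hφ hM hN0 hτ (one_le_sobolevWeight m ξ)
        ha ha1 hb (by positivity) hκ.le (by rw [hMdef, div_mul_cancel₀ _ (by positivity)])
        hN1 hN2 (hpc ξ) (fun t ht => (hsymb t (hsub ht) ξ).2)
        (fun t ht => (hsymb t (hsub ht) ξ).1)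
        (fun t ht s hs => abs_operatorSymbol_sub_le hR (hsub ht) (hsub hs) ξ) ht)
      hend
      (fun ξ => crossingLevel_sub_le hφ hN0 hτ (one_le_sobolevWeight m ξ) ha1 hb (hpc ξ)
        fun t ht => (hsymb t (hsub ht) ξ).2)
      ⟨hτ'0, hlt.le⟩
  have hw0 : ∀ t ∈ Ico 0 T, w t = 0 := by
    intro t ht
    obtain ⟨τ', htτ', hτ'T⟩ := exists_between ht.2
    have hτ'0 : 0 < τ' := ht.1.trans_lt htτ'
    have : (ae (volume.restrict (Ioo τ' T))).NeBot := by
      rw [ae_neBot, Ne, Measure.restrict_eq_zero, Real.volume_Ioo]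
      simpa using hτ'T
    -- The final time must be one at which `∫ X |w(τ)|²` is known to be finite; almost every time
    -- qualifies.
    obtain ⟨τ, hτ1, hτ2⟩ := ((ae_restrict_mem measurableSet_Ioo).and
      (ae_restrict_of_ae (s := Ioo τ' T) hgood)).exists
    have hle := hzero τ' τ hτ'0.le hτ1.1 hτ1.2.le
      (hτ2 ⟨(hτ'0.trans hτ1.1).le, hτ1.2.le⟩).1
    by_contra hne
    refine absurd hle (not_le.2 (intervalIntegral.integral_pos hτ'0 ?_ (fun s _ => by positivity)
      ⟨t, ⟨ht.1, htτ'.le⟩, ?_⟩))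
    · exact (hwc.mono (Icc_subset_Icc_right hτ'T.le)).norm.pow 2
    · have := norm_pos_iff.2 hne
      positivity
  have hTae : ∀ᵐ t ∂(volume.restrict (Icc 0 T)), t ≠ T :=
    ae_restrict_of_ae (Measure.ae_ne volume T)
  filter_upwards [huw, hTae, ae_restrict_mem measurableSet_Icc] with t h1 h2 h3
  have hwt := hw0 t ⟨h3.1, lt_of_le_of_ne h3.2 h2⟩
  rw [← hFw t h3, ← h1] at hwt
  exact (Lp.fourierTransformₗᵢ (EuclideanSpace ℝ (Fin n)) ℂ).map_eq_zero_iff.1 hwt
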